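/- Identify $\mathbb R^2$ with $\mathbb C$. A solid of shape $S_0$ (a compact set) occupies a domain $S=p(S_0)$, where $p(x)=e^{i\theta}(x-s)+r$, and moves with a rigid velocity field $v(x)=i\omega(x-s')+w$, where $\theta,\omega\in\mathbb R$ and $s,r,s',w\in\mathbb C$. Its position is the set $S$ and its velocity is the field $v$. The complex potential of the surrounding fluid is the function $\xi$, holomorphic in $\mathcal F=\mathbb C\setminus S$, with $\xi\to0$ and $\xi'\to0$ at infinity, whose fluid velocity $u=\overline{\xi'}$ is continuous up to the boundary and satisfies $u\cdot n=v\cdot n$ on $\partial S$, where $n$ is a unit normal. The shape $S_0$ is called detectable if the potential determines the configuration of the moving solid: whenever two configurations with positions $S_1,S_2$ and velocities $v_1\neq0$ and $v_2$ have complex potentials $\xi_1,\xi_2$ which coincide on some nonempty open subset of $\mathcal F_1\cap\mathcal F_2$, then $S_1=S_2$ and $v_1=v_2$. **Proposition 1.1.** Every (non-circular) ellipse, with semi-axes $a>b>0$, is detectable. More precisely, let $S=e^{i\alpha}E+r$ with $E=\{x+iy: x^2/a^2+y^2/b^2\le1\}$, $a>b>0$, $\alpha\in\mathbb R$, $r\in\mathbb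 C$, and let $v(x)=i\omega(x-r)+e^{i\alpha}w_0$ with $\omega\in\mathbb R$, $w_0\in\mathbb C$. Then the complex potential exists, is unique in $\mathcal F$, and is given by $$\xi(z)=-\frac{\big[(a+b)^2w_0-(a^2-b^2)\overline{w_0}\big]e^{i\alpha}}{2D(z)}-\frac{i(a^2-b^2)(a+b)^2e^{2i\alpha}\omega}{4D(z)^2},\qquad D(z)=(z-r)\Big(1+\sqrt{1-\tfrac{(a^2-b^2)e^{2i\alpha}}{(z-r)^2}}\Big),$$ with the principal square root. This formula defines a holomorphic function on the complement of the segment with endpoints $r\pm\sqrt{a^2-b^2}\,e^{i\alpha}$. If $v\ne0$, both endpoints are branch points of square root type: near such an endpoint $p$, with $d=e^{i\alpha}$ at $p=r+\sqrt{a^2-b^2}\,e^{i\alpha}$ and $d=-e^{i\alpha}$ at $p=r-\sqrt{a^2-b^2}\,e^{i\alpha}$, $\xi(z)=h(\sqrt{(z-p)/d})$ off the segment, with $h$ holomorphic near $0$ and not even. Moreover the limits $$\mu=\lim_{|z|\to\infty}\frac{e^{-i\alpha}\xi(z)z}{a+b},\qquad \nu=\lim_{|z|\to\infty}\Big[\big(e^{-i\alpha}(z-r)\big)^2\xi(z)-(a+b)\,\mu\,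 e^{-i\alpha}(z-r)\Big]$$ exist, and $$w_0=-\Big(\frac{\mu+\overline\mu}{b}+\frac{\mu-\overline\mu}{a}\Big),\qquad \omega=\frac{16\,i\,\nu}{(a^2-b^2)(a+b)^2}.$$ -/

import Mathlib

open Set Filter Topology
open scoped ComplexConjugate

/-!
The plane `ℝ²` is identified with `ℂ` (as a real inner product space): `x^⊥ = i x`, and the rotation
of angle `θ` is the multiplication by `e^{iθ}`.
-/

/-- A triplet `(θ, s, r)`, representing the rigid displacement `x ↦ R(θ)(x - s) + r` of the plane. -/
structure Placement where
  angle : ℝ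
  pivot : ℂ
  shift : ℂ

/-- `p x = R(θ)(x - s) + r`. -/
noncomputable def Placement.map (p : Placement) (x : ℂ) : ℂ :=
  Complex.exp (p.angle * Complex.I) * (x - p.pivot) + p.shift

/-- The domain occupied by the solid of shape `S₀` placed by `p`. Two triplets represent the same
position of the solid of shape `S₀` exactly when these domains are equal. -/
noncomputable def Placement.solid (p : Placement) (S₀ : Set ℂ) : Set ℂ :=
  p.map '' S₀

/-- A triplet `(ω, s, w)`, representing the rigid velocity field `x ↦ ω (x - s)^⊥ + w`. -/
structure RigidVelocity where
  angular : ℝ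
  pivot : ℂ
  linear : ℂ

/-- `v(x) = ω (x - s)^⊥ + w`. Two triplets represent the same rigid velocity exactly when these
fields are equal. -/
noncomputable def RigidVelocity.field (v : RigidVelocity) (x : ℂ) : ℂ :=
  v.angular * (Complex.I * (x - v.pivot)) + v.linear

/-- The domain `ℝ² \ closure S` filled by the fluid around the solid `S`. -/
def fluidDomain (S : Set ℂ) : Set ℂ :=
  (closure S)ᶜ

/-- `n` is one of the two unit normal vectors to the boundary of `S` at `x`: it has length one and
is orthogonal to all the vectors tangent to the boundary at `x`. -/
def IsUnitNormal (S : Set ℂ) (x n : ℂ) : Prop :=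
  ‖n‖ = 1 ∧ ∀ τ ∈ tangentConeAt ℝ (frontier S) x, inner ℝ τ n = 0

/-- The complex velocity `u = u₁ + i u₂ = conj ξ'` of the fluid of complex potential `ξ = φ + iψ`.
By the Cauchy-Riemann equations this is `∇φ`. -/
noncomputable def fluidVelocity (ξ : ℂ → ℂ) (z : ℂ) : ℂ :=
  conj (deriv ξ z)

/-- `ξ` is the complex potential of the fluid surrounding the solid `S` which moves with the rigid
velocity `v`: `ξ` is holomorphic in the fluid domain, it is normalized by `ξ → 0` at infinity, the
fluid is at rest at infinity, and the fluid velocity `u` is continuous up to the boundary, where it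
satisfies the slip condition `u ⬝ n = v ⬝ n`. (This condition does not depend on the sign
of `n`. The values of `ξ` outside of the fluid domain play no role.) -/
structure IsComplexPotential (S : Set ℂ) (v : RigidVelocity) (ξ : ℂ → ℂ) : Prop where
  holomorphic : DifferentiableOn ℂ ξ (fluidDomain S)
  decay : Tendsto ξ (cocompact ℂ) (𝓝 0)
  rest : Tendsto (fluidVelocity ξ) (cocompact ℂ) (𝓝 0)
  slip : ∃ u : ℂ → ℂ, ContinuousOn u (closure (fluidDomain S)) ∧
    EqOn u (fluidVelocity ξ) (fluidDomain S) ∧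
    ∀ x ∈ frontier S, ∀ n, IsUnitNormal S x n → inner ℝ (u x) n = inner ℝ (v.field x) n

/-- A solid of shape `S₀` is detectable if every configuration of the moving solid can be recovered
from the potential, even when this potential is only measured in some nonempty open set `U`:
if a configuration `(p₂, v₂)` is compatible with the measurement of the potential for
`(p₁, v₁)`, with `v₁ ≠ 0`, then it has the same position and the same velocity. -/
def Detectable (S₀ : Set ℂ) : Prop :=
  ∀ (p₁ p₂ : Placement) (v₁ v₂ : RigidVelocity) (ξ₁ ξ₂ : ℂ → ℂ),
    v₁.field ≠ 0 →
    IsComplexPotential (p₁.solid S₀) v₁ ξ₁ →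
    IsComplexPotential (p₂.solid S₀) v₂ ξ₂ →
    (∃ U : Set ℂ, IsOpen U ∧ U.Nonempty ∧
      U ⊆ fluidDomain (p₁.solid S₀) ∩ fluidDomain (p₂.solid S₀) ∧ EqOn ξ₁ ξ₂ U) →
    p₁.solid S₀ = p₂.solid S₀ ∧ v₁.field = v₂.field

/-- The solid ellipse `x² / a² + y² / b² ≤ 1`. -/
def standardEllipse (a b : ℝ) : Set ℂ :=
  {z | (z.re / a) ^ 2 + (z.im / b) ^ 2 ≤ 1}

/-- Ellipses of the plane, with semi-axes `a > b > 0`, any centre and any orientation. -/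
def IsEllipse (S : Set ℂ) : Prop :=
  ∃ (a b : ℝ) (q : Placement), 0 < b ∧ b < a ∧ S = q.solid (standardEllipse a b)

/-- The expression `(z - r) (1 + √(1 - (a² - b²) e^{2iα} / (z - r)²))`, with the principal
determination of the square root. -/
noncomputable def ellipseDenom (a b α : ℝ) (r z : ℂ) : ℂ :=
  (z - r) * (1 + Complex.sqrt
    (1 - ((a : ℂ) ^ 2 - (b : ℂ) ^ 2) * Complex.exp (2 * α * Complex.I) / (z - r) ^ 2))

/-- The explicit potential for the ellipse of semi-axes `a > b > 0`, of centre `r` and orientation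
`α`, moving with the velocity `ω (x - r)^⊥ + e^{iα} w₀`. -/
noncomputable def ellipsePotential (a b α : ℝ) (r : ℂ) (ω : ℝ) (w₀ : ℂ) (z : ℂ) : ℂ :=
  -((((a : ℂ) + b) ^ 2 * w₀ - ((a : ℂ) ^ 2 - (b : ℂ) ^ 2) * conj w₀) * Complex.exp (α * Complex.I)
      / (2 * ellipseDenom a b α r z)
    + Complex.I * ((a : ℂ) ^ 2 - (b : ℂ) ^ 2) * ((a : ℂ) + b) ^ 2 * Complex.exp (2 * α * Complex.I) * ω
      / (4 * ellipseDenom a b α r z ^ 2))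

/-- `p` is a branch point of square root type of the (determination of the) function `f`:
near `p`, cut along the radius of direction `-d`, `f` is a holomorphic function `h` of
`√((z - p) / d)`, and `h` is not even, so that `f` does not come back to
the same values after one turn around `p`. -/
def IsSqrtBranchPoint (f : ℂ → ℂ) (p d : ℂ) : Prop :=
  ∃ (ρ : ℝ) (h : ℂ → ℂ), 0 < ρ ∧ DifferentiableOn ℂ h (Metric.ball 0 ρ) ∧
    (∀ z, ‖z - p‖ < ρ ^ 2 → (z - p) / d ∈ Complex.slitPlane →
      f z = h (Complex.sqrt ((z - p) / d))) ∧
    ∃ s ∈ Metric.ball (0 : ℂ) ρ, h (-s) ≠ h s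

/-! The Joukowsky map carries the exterior of the unit disc onto the exterior of the ellipse, and in
the coordinate ζ the denominator z + √(z² - κ), with κ = a² - b², is simply (a + b)ζ. The potential
is therefore a quadratic polynomial in 1/ζ. It is holomorphic off the focal segment, which lies
strictly inside the ellipse, and the slip condition becomes an identity on |ζ| = 1
(`isComplexPotential_ellipsePotential`). For uniqueness, the difference of two potentials, read in w
= 1/ζ, is a holomorphic f on the disc such that w f'(w) has zero real part on the circle. Hence w
f'(w) is constant, equal to its value 0 at w = 0, and decay at infinity gives f = 0
(`eq_zero_of_tangent_flow`).

Detectability is then algebraic. Rationalising the denominator writes the potential as P + Q√D with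
polynomials P, Q, D, where D has simple roots exactly at the foci and Q = 0 only for zero velocity.
If two such functions agree on an infinite set, squaring twice and comparing parities of root
multiplicities shows that each focus of the first ellipse is a focus of the second
(`Polynomial.isRoot_of_add_mul_sqrt_eq`). Since a and b are known, the ellipses coincide; then so do
the polynomials Q, which determine the velocity.

The same decomposition gives the branch points: in a local parameter s with s² proportional to z -
p, P is even and Q√D is odd. The limits μ and ν read off the first two coefficients at infinity. -/

namespace Complex

/-! ### The principal square root. -/

theorem sqrt_sq_eq (z : ℂ) : Complex.sqrt z ^ 2 = z := by
  unfold Complex.sqrt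
  exact_mod_cast cpow_nat_inv_pow z (n := 2) two_ne_zero

theorem sqrt_re_nonneg (z : ℂ) : 0 ≤ (Complex.sqrt z).re := by
  unfold Complex.sqrt
  rw [cpow_inv_two_re]
  positivity

theorem sqrt_re_pos {z : ℂ} (hz : z ∈ slitPlane) : 0 < (Complex.sqrt z).re := by
  refine lt_of_le_of_ne (sqrt_re_nonneg z) fun h => ?_
  have h2 := sqrt_sq_eq z
  rw [mem_slitPlane_iff, ← h2] at hz
  simp only [sq, mul_re, mul_im, ← h] at hz
  rcases hz with hz | hz
  · nlinarith [sq_nonneg (Complex.sqrt z).im]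
  · simp at hz

theorem sqrt_eq_of_sq_eq {y z : ℂ} (hy : 0 < y.re) (h : y ^ 2 = z) : Complex.sqrt z = y := by
  have h2 := sqrt_sq_eq z
  rw [← h, sq_eq_sq_iff_eq_or_eq_neg, h] at h2
  rcases h2 with h2 | h2
  · exact h2
  · have := sqrt_re_nonneg z
    rw [h2, neg_re] at this
    linarith

end Complex

/-! ### The root √(z² - κ) and the potential in the frame of the ellipse. -/

open Complex (slitPlane)

/-- The determination `z √(1 - κ / z²)` of `√(z² - κ)`. -/
noncomputable def focalRoot (κ z : ℂ) : ℂ := z * Complex.sqrt (1 - κ / z ^ 2)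

theorem focalRoot_sq (κ : ℂ) {z : ℂ} (hz : z ≠ 0) : focalRoot κ z ^ 2 = z ^ 2 - κ := by
  rw [focalRoot, mul_pow, Complex.sqrt_sq_eq]
  field_simp

theorem focalRoot_eq {κ z y : ℂ} (hz : z ≠ 0) (h : y ^ 2 = z ^ 2 - κ) (hy : 0 < (y / z).re) :
    focalRoot κ z = y := by
  rw [focalRoot, Complex.sqrt_eq_of_sq_eq hy]
  · field_simp
  · rw [div_pow, h]
    field_simp

/-- With ε = ±1 this oddness lets one computation serve both foci. -/
theorem focalRoot_mul_of_sq_eq_one {ε : ℂ} (hε : ε ^ 2 = 1) (κ z : ℂ) :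
    focalRoot κ (ε * z) = ε * focalRoot κ z := by
  simp [focalRoot, mul_pow, hε, mul_assoc]

theorem add_focalRoot_mul_sub (κ : ℂ) {z : ℂ} (hz : z ≠ 0) :
    (z + focalRoot κ z) * (z - focalRoot κ z) = κ := by
  linear_combination -focalRoot_sq κ hz

theorem add_focalRoot_ne_zero {κ z : ℂ} (hκ : κ ≠ 0) (hz : z ≠ 0) : z + focalRoot κ z ≠ 0 :=
  left_ne_zero_of_mul ((add_focalRoot_mul_sub κ hz).trans_ne hκ)

/-- The potential in the frame of the ellipse. -/
noncomputable def alignedPotential (κ m n z : ℂ) : ℂ :=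
  -(m / (2 * (z + focalRoot κ z)) + n / (4 * (z + focalRoot κ z) ^ 2))

/-- `add_focalRoot_mul_sub` replaces the inverse of z + R by (z - R)/κ, and R² = z² - κ leaves an
expression affine in R: the form P + QR on which the branch point and detectability arguments rest.
-/
theorem alignedPotential_eq {κ z : ℂ} (hκ : κ ≠ 0) (hz : z ≠ 0) (m n : ℂ) :
    alignedPotential κ m n z = -(m / (2 * κ) * z + n / (4 * κ ^ 2) * (2 * z ^ 2 - κ))
      + (m / (2 * κ) + n / (2 * κ ^ 2) * z) * focalRoot κ z := by
  have h := add_focalRoot_mul_sub κ hz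
  have h0 := add_focalRoot_ne_zero hκ hz
  have h1 : (z + focalRoot κ z)⁻¹ = (z - focalRoot κ z) / κ := by
    rw [eq_div_iff hκ, inv_mul_eq_iff_eq_mul₀ h0, h]
  have : alignedPotential κ m n z = -(m / 2 * (z + focalRoot κ z)⁻¹
      + n / 4 * (z + focalRoot κ z)⁻¹ ^ 2) := by
    rw [alignedPotential]; field_simp
  rw [this, h1]
  field_simp
  linear_combination (-2 * n) * focalRoot_sq κ hz

/-- Off the slit plane, k²/z² would be a real t ≥ 1; then k² = t z² forces z to be real with |z| ≤
k. -/
theorem one_sub_div_sq_mem_slitPlane {k : ℝ} (hk : 0 < k) {z : ℂ}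
    (hz : z ∉ Complex.ofReal '' Icc (-k) k) : 1 - (k : ℂ) ^ 2 / z ^ 2 ∈ slitPlane := by
  by_contra hc
  have hz0 : z ≠ 0 := fun h => hz ⟨0, by constructor <;> linarith, by simp [h]⟩
  rw [Complex.mem_slitPlane_iff] at hc
  push Not at hc
  obtain ⟨h1, h2⟩ := hc
  set t : ℝ := ((k : ℂ) ^ 2 / z ^ 2).re with ht
  have h3 : (k : ℂ) ^ 2 / z ^ 2 = t := by
    apply Complex.ext
    · simp [ht]
    · simpa using h2
  have h4 : 1 ≤ t := by simp only [Complex.sub_re, Complex.one_re] at h1; linarith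
  have h5 : (k : ℂ) ^ 2 = t * z ^ 2 := by
    rw [← h3]; field_simp
  have h6 := congrArg Complex.re h5
  have h7 := congrArg Complex.im h5
  simp only [sq, Complex.mul_re, Complex.mul_im, Complex.ofReal_re, Complex.ofReal_im] at h6 h7
  have h8 : z.re * z.im = 0 := by
    have : t * (z.re * z.im) = 0 := by linarith
    rcases mul_eq_zero.1 this with h | h
    · linarith
    · exact h
  have him : z.im = 0 := by
    rcases mul_eq_zero.1 h8 with h | h
    · rw [h] at h6; nlinarith [sq_nonneg z.im, mul_pos hk hk]
    · exact h
  refine hz ⟨z.re, abs_le.1 (abs_le_of_sq_le_sq ?_ hk.le), Complex.ext (by simp) (by simp [him])⟩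
  rw [him] at h6
  nlinarith [sq_nonneg z.re]

theorem differentiableAt_focalRoot {κ z : ℂ} (hz : z ≠ 0) (h : 1 - κ / z ^ 2 ∈ slitPlane) :
    DifferentiableAt ℂ (focalRoot κ) z := by
  unfold focalRoot
  refine differentiableAt_id.mul
    ((Complex.hasDerivAt_sqrt h).differentiableAt.comp z (f := fun z => 1 - κ / z ^ 2) ?_)
  exact (differentiableAt_const _).sub ((differentiableAt_const _).div (by fun_prop) (by simpa))

theorem differentiableAt_alignedPotential {k : ℝ} (hk : 0 < k) {z : ℂ}
    (hz : z ∉ Complex.ofReal '' Icc (-k) k) (m n : ℂ) :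
    DifferentiableAt ℂ (alignedPotential (k ^ 2) m n) z := by
  have hz0 : z ≠ 0 := fun h => hz ⟨0, by constructor <;> linarith, by simp [h]⟩
  have hR := differentiableAt_focalRoot hz0 (one_sub_div_sq_mem_slitPlane hk hz)
  have h0 : z + focalRoot (k ^ 2) z ≠ 0 :=
    add_focalRoot_ne_zero (by exact_mod_cast (pow_pos hk 2).ne') hz0
  unfold alignedPotential
  refine (DifferentiableAt.add ?_ ?_).neg
  · exact (differentiableAt_const _).div (by fun_prop) (by simpa)
  · exact (differentiableAt_const _).div (by fun_prop) (by simpa)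

/-! ### The potential in the Joukowsky coordinate. -/

/-- The conformal map from the exterior of the unit disc to the exterior of the ellipse of
semi-axes `a`, `b`. -/
noncomputable def joukowsky (a b : ℝ) (ζ : ℂ) : ℂ := ((a + b) * ζ + (a - b) / ζ) / 2

/-- The function `ζ ↦ ζ J'(ζ)`, where `J` is the conformal map `joukowsky`. -/
noncomputable def joukowskyNormal (a b : ℝ) (ζ : ℂ) : ℂ := ((a + b) * ζ - (a - b) / ζ) / 2

/-- The squares agree, and the sign is right because the quotient of the two functions is (1 - s)/(1
+ s) with |s| < 1, which has positive real part. The hypothesis also admits some ζ inside the unit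
circle, so that the formula can be differentiated at boundary points. -/
theorem focalRoot_joukowsky {a b : ℝ} (hb : 0 < b) (hab : b < a) {ζ : ℂ}
    (hζ : a - b < (a + b) * ‖ζ‖ ^ 2) :
    joukowsky a b ζ ≠ 0 ∧ focalRoot ((a : ℂ) ^ 2 - b ^ 2) (joukowsky a b ζ) = joukowskyNormal a b ζ := by
  have hζ0 : ζ ≠ 0 := by rintro rfl; norm_num at hζ; linarith
  have hs : (0 : ℝ) < a + b := by linarith
  have hs' : (a : ℂ) + b ≠ 0 := by exact_mod_cast hs.ne'
  set s : ℂ := (a - b) / ((a + b) * ζ ^ 2) with hsdef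
  have hns : ‖s‖ < 1 := by
    have h1 : ‖(a : ℂ) - b‖ = a - b := by
      rw [← Complex.ofReal_sub, Complex.norm_real, Real.norm_of_nonneg (by linarith)]
    have h2 : ‖(a : ℂ) + b‖ = a + b := by
      rw [← Complex.ofReal_add, Complex.norm_real, Real.norm_of_nonneg (by linarith)]
    rw [hsdef, norm_div, norm_mul, norm_pow, h1, h2, div_lt_one (by positivity)]
    exact hζ
  have h1s : 1 + s ≠ 0 := by
    intro h
    have : s = -1 := by linear_combination h
    rw [this] at hns; simp at hns
  have hJ : joukowsky a b ζ = (a + b) * ζ / 2 * (1 + s) := by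
    rw [joukowsky, hsdef]; field_simp
  have hN : joukowskyNormal a b ζ = (a + b) * ζ / 2 * (1 - s) := by
    rw [joukowskyNormal, hsdef]; field_simp
  have hJ0 : joukowsky a b ζ ≠ 0 := by
    rw [hJ]
    exact mul_ne_zero (by simp [hs', hζ0]) h1s
  refine ⟨hJ0, focalRoot_eq hJ0 ?_ ?_⟩
  · rw [joukowsky, joukowskyNormal]
    field_simp
    ring
  · have : joukowskyNormal a b ζ / joukowsky a b ζ = (1 - s) / (1 + s) := by
      rw [hJ, hN]; field_simp
    rw [this, Complex.div_re, ← add_div]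
    apply div_pos _ (Complex.normSq_pos.2 h1s)
    have : ‖s‖ ^ 2 < 1 := by nlinarith [norm_nonneg s]
    rw [← Complex.normSq_eq_norm_sq, Complex.normSq_apply] at this
    simp only [Complex.sub_re, Complex.add_re, Complex.one_re, Complex.sub_im, Complex.add_im,
      Complex.one_im]
    nlinarith

theorem alignedPotential_joukowsky {a b : ℝ} (hb : 0 < b) (hab : b < a) {ζ : ℂ}
    (hζ : a - b < (a + b) * ‖ζ‖ ^ 2) (m n : ℂ) :
    alignedPotential ((a : ℂ) ^ 2 - b ^ 2) m n (joukowsky a b ζ) =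
      -(m / (2 * (a + b)) / ζ + n / (4 * (a + b) ^ 2) / ζ ^ 2) := by
  have hζ0 : ζ ≠ 0 := by rintro rfl; norm_num at hζ; linarith
  have hs' : (a : ℂ) + b ≠ 0 := by exact_mod_cast (by linarith : (a + b : ℝ) ≠ 0)
  have : joukowsky a b ζ + joukowskyNormal a b ζ = (a + b) * ζ := by
    rw [joukowsky, joukowskyNormal]; ring
  rw [alignedPotential, (focalRoot_joukowsky hb hab hζ).2, this]
  field_simp

theorem ellipsePotential_eq (a b α : ℝ) (r : ℂ) (ω : ℝ) (w₀ z : ℂ) :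
    ellipsePotential a b α r ω w₀ z =
      alignedPotential ((a : ℂ) ^ 2 - b ^ 2)
        (((a : ℂ) + b) ^ 2 * w₀ - ((a : ℂ) ^ 2 - b ^ 2) * conj w₀)
        (Complex.I * ((a : ℂ) ^ 2 - b ^ 2) * ((a : ℂ) + b) ^ 2 * ω)
        (Complex.exp (-(α * Complex.I)) * (z - r)) := by
  have he : Complex.exp (2 * α * Complex.I) = Complex.exp (α * Complex.I) ^ 2 := by
    rw [← Complex.exp_nat_mul]; congr 1; push_cast; ring
  have he0 := Complex.exp_ne_zero (α * Complex.I)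
  have hD : ellipseDenom a b α r z = Complex.exp (α * Complex.I) *
      (Complex.exp (-(α * Complex.I)) * (z - r) +
        focalRoot ((a : ℂ) ^ 2 - b ^ 2) (Complex.exp (-(α * Complex.I)) * (z - r))) := by
    have : ((a : ℂ) ^ 2 - b ^ 2) / (Complex.exp (-(α * Complex.I)) * (z - r)) ^ 2
        = ((a : ℂ) ^ 2 - b ^ 2) * Complex.exp (α * Complex.I) ^ 2 / (z - r) ^ 2 := by
      rw [Complex.exp_neg]; field_simp
    rw [ellipseDenom, focalRoot, this, he, Complex.exp_neg]
    field_simp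
  rw [ellipsePotential, alignedPotential, hD, he]
  set D := (Complex.exp (-(α * Complex.I)) * (z - r) +
        focalRoot ((a : ℂ) ^ 2 - b ^ 2) (Complex.exp (-(α * Complex.I)) * (z - r)))
  congr 2
  · rw [mul_left_comm, mul_comm (Complex.exp _), mul_div_mul_right _ _ he0]
  · rw [mul_pow, mul_left_comm, mul_right_comm _ _ (ω : ℂ), mul_comm (Complex.exp _ ^ 2),
      mul_div_mul_right _ _ (pow_ne_zero 2 he0)]

/-! ### Expansion at infinity. -/

theorem tendsto_inv_cocompact : Tendsto (fun z : ℂ => z⁻¹) (cocompact ℂ) (𝓝 0) :=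
  tendsto_inv₀_cobounded.comp (Metric.cobounded_eq_cocompact (α := ℂ)).ge

theorem tendsto_sqrt_one_sub (κ : ℂ) :
    Tendsto (fun z : ℂ => Complex.sqrt (1 - κ / z ^ 2)) (cocompact ℂ) (𝓝 1) := by
  have h1 : Tendsto (fun z : ℂ => 1 - κ * (z⁻¹) ^ 2) (cocompact ℂ) (𝓝 (1 - κ * 0 ^ 2)) :=
    (tendsto_inv_cocompact.pow 2).const_mul κ |>.const_sub 1
  have h2 : ContinuousAt Complex.sqrt 1 :=
    (Complex.hasDerivAt_sqrt (Complex.one_mem_slitPlane)).continuousAt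
  have h3 : Tendsto Complex.sqrt (𝓝 (1 - κ * 0 ^ 2)) (𝓝 1) := by
    simpa using h2.tendsto
  exact (h3.comp h1).congr fun z => by simp [div_eq_mul_inv]

theorem one_add_sqrt_ne_zero (z : ℂ) : 1 + Complex.sqrt z ≠ 0 := by
  intro h
  have := congrArg Complex.re h
  have h2 := Complex.sqrt_re_nonneg z
  simp only [Complex.add_re, Complex.one_re, Complex.zero_re] at this
  linarith

theorem add_focalRoot_eq (κ z : ℂ) :
    z + focalRoot κ z = z * (1 + Complex.sqrt (1 - κ / z ^ 2)) := by
  rw [focalRoot]; ring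

theorem eventually_ne_cocompact (w : ℂ) : ∀ᶠ z in cocompact ℂ, z ≠ w :=
  (isCompact_singleton (x := w)).compl_mem_cocompact

theorem tendsto_alignedPotential_mul (κ m n : ℂ) :
    Tendsto (fun z => alignedPotential κ m n z * z) (cocompact ℂ) (𝓝 (-(m / 4))) := by
  have hσ := (tendsto_sqrt_one_sub κ).const_add 1
  have h1 : Tendsto (fun z : ℂ => -(m / (2 * (1 + Complex.sqrt (1 - κ / z ^ 2))) +
      n / (4 * (1 + Complex.sqrt (1 - κ / z ^ 2)) ^ 2) * z⁻¹)) (cocompact ℂ)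
      (𝓝 (-(m / (2 * (1 + 1)) + n / (4 * (1 + 1) ^ 2) * 0))) := by
    refine (Tendsto.add ?_ (Tendsto.mul ?_ tendsto_inv_cocompact)).neg
    · exact tendsto_const_nhds.div (hσ.const_mul 2) (by norm_num)
    · exact tendsto_const_nhds.div ((hσ.pow 2).const_mul 4) (by norm_num)
  have h2 : (-(m / (2 * (1 + 1)) + n / (4 * (1 + 1) ^ 2) * 0)) = -(m / 4) := by norm_num
  rw [h2] at h1
  refine h1.congr' ?_
  filter_upwards [eventually_ne_cocompact 0] with z hz
  rw [alignedPotential, add_focalRoot_eq]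
  have := one_add_sqrt_ne_zero (1 - κ / z ^ 2)
  set σ := Complex.sqrt (1 - κ / z ^ 2)
  field_simp

theorem tendsto_alignedPotential (κ m n : ℂ) :
    Tendsto (alignedPotential κ m n) (cocompact ℂ) (𝓝 0) := by
  have := (tendsto_alignedPotential_mul κ m n).mul tendsto_inv_cocompact
  rw [mul_zero] at this
  refine this.congr' ?_
  filter_upwards [eventually_ne_cocompact 0] with z hz
  field_simp

/-- With σ = √(1 - κ/z²), the identity 1 - σ² = κ/z² turns the divergent terms -mz/(2(1 + σ)) + mz/4
into -mκ/(4z(1 + σ)²), which tends to 0. -/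
theorem tendsto_alignedPotential_sq (κ m n : ℂ) :
    Tendsto (fun z => z ^ 2 * alignedPotential κ m n z + m / 4 * z) (cocompact ℂ)
      (𝓝 (-(n / 16))) := by
  have hσ := (tendsto_sqrt_one_sub κ).const_add 1
  have h1 : Tendsto (fun z : ℂ => -(m * κ / (4 * (1 + Complex.sqrt (1 - κ / z ^ 2)) ^ 2) * z⁻¹ +
      n / (4 * (1 + Complex.sqrt (1 - κ / z ^ 2)) ^ 2))) (cocompact ℂ)
      (𝓝 (-(m * κ / (4 * (1 + 1) ^ 2) * 0 + n / (4 * (1 + 1) ^ 2)))) := by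
    refine (Tendsto.add (Tendsto.mul ?_ tendsto_inv_cocompact) ?_).neg
    · exact tendsto_const_nhds.div ((hσ.pow 2).const_mul 4) (by norm_num)
    · exact tendsto_const_nhds.div ((hσ.pow 2).const_mul 4) (by norm_num)
  have h2 : (-(m * κ / (4 * (1 + 1) ^ 2) * 0 + n / (4 * (1 + 1) ^ 2))) = -(n / 16) := by norm_num
  rw [h2] at h1
  refine h1.congr' ?_
  filter_upwards [eventually_ne_cocompact 0] with z hz
  rw [alignedPotential, add_focalRoot_eq]
  have := one_add_sqrt_ne_zero (1 - κ / z ^ 2)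
  have hs := Complex.sqrt_sq_eq (1 - κ / z ^ 2)
  set σ := Complex.sqrt (1 - κ / z ^ 2)
  have hκ : κ = z ^ 2 * (1 - σ ^ 2) := by rw [hs]; field_simp; ring
  rw [hκ]
  field_simp
  ring

/-! ### Square root branching at the foci. -/

/-- For z = k + s² one has z² - k² = s²(2k + s²); only the sign of the root has to be settled, by
the positivity of Re(sT/z) with T = √(2k + s²). -/
theorem focalRoot_add_sq {k : ℝ} {s : ℂ} (hs : 0 < s.re) (hsk : ‖s‖ ^ 2 < k) :
    (k : ℂ) + s ^ 2 ≠ 0 ∧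
      focalRoot (k ^ 2) (k + s ^ 2) = s * Complex.sqrt (2 * k + s ^ 2) := by
  have hre : |(s ^ 2).re| ≤ ‖s‖ ^ 2 := (Complex.abs_re_le_norm _).trans (norm_pow s 2).le
  have hre' := neg_abs_le (s ^ 2).re
  have hk0 : 0 < k := (sq_nonneg _).trans_lt hsk
  have h2 : 0 < (2 * k + s ^ 2 : ℂ).re := by
    simp only [Complex.add_re, Complex.mul_re, Complex.re_ofNat, Complex.im_ofNat,
      Complex.ofReal_re]
    linarith
  have hz0 : (k : ℂ) + s ^ 2 ≠ 0 := fun h => by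
    have := congrArg Complex.re h
    simp only [Complex.add_re, Complex.zero_re, Complex.ofReal_re] at this
    linarith
  have hT := Complex.sqrt_re_pos (Complex.mem_slitPlane_iff.2 (Or.inl h2))
  have hT2 := Complex.sqrt_sq_eq (2 * k + s ^ 2)
  set T := Complex.sqrt (2 * k + s ^ 2)
  refine ⟨hz0, focalRoot_eq hz0 (by rw [mul_pow, hT2]; ring) ?_⟩
  -- T² and s² have the same imaginary part and both real parts are positive, so Im T and Im s
  -- cannot have opposite signs; hence Re(s · conj T) > 0.
  have him : T.re * T.im = s.re * s.im := by
    have := congrArg Complex.im hT2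
    simp only [sq, Complex.add_im, Complex.mul_im, Complex.re_ofNat, Complex.im_ofNat,
      Complex.ofReal_re, Complex.ofReal_im] at this
    linarith
  have hmul : 0 ≤ T.im * s.im := by
    have : T.re * s.re * (T.im * s.im) = (s.re * s.im) ^ 2 := by
      rw [sq]; nth_rw 1 [← him]; ring
    refine nonneg_of_mul_nonneg_right (this ▸ sq_nonneg _) (mul_pos hT hs)
  have hz : (k : ℂ) + s ^ 2 = (s ^ 2 + T ^ 2) / 2 := by rw [hT2]; ring
  rw [Complex.div_re, ← add_div]
  apply div_pos _ (Complex.normSq_pos.2 hz0)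
  have key : (s * T).re * ((k : ℂ) + s ^ 2).re + (s * T).im * ((k : ℂ) + s ^ 2).im =
      (s.re * T.re + T.im * s.im) * (Complex.normSq s + Complex.normSq T) / 2 := by
    rw [hz]
    simp only [sq, Complex.div_ofNat_re, Complex.div_ofNat_im, Complex.add_re, Complex.add_im,
      Complex.mul_re, Complex.mul_im, Complex.normSq_apply]
    ring
  rw [key]
  have h3 : 0 < s.re * T.re + T.im * s.im := by have := mul_pos hs hT; linarith
  have h4 : 0 < Complex.normSq s := Complex.normSq_pos.2 (fun h => by simp [h] at hs)
  have h5 := Complex.normSq_nonneg T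
  positivity

theorem isSqrtBranchPoint_alignedPotential {k : ℝ} (hk : 0 < k) {ε e : ℂ} (hε : ε ^ 2 = 1)
    (he : ‖e‖ = 1) (r : ℂ) {m n : ℂ} (hmn : m ≠ 0 ∨ n ≠ 0) :
    IsSqrtBranchPoint (fun z => alignedPotential (k ^ 2) m n (e⁻¹ * (z - r)))
      (r + ε * (k * e)) (ε * e) := by
  have hk0 : (k : ℂ) ≠ 0 := by exact_mod_cast hk.ne'
  have he0 : e ≠ 0 := fun h => by simp [h] at he
  have hε0 : ε ≠ 0 := fun h => by simp [h] at hε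
  have hεn : ‖ε‖ = 1 := by
    have := congrArg norm hε
    rw [norm_pow, norm_one] at this
    exact (pow_eq_one_iff_of_nonneg (norm_nonneg _) two_ne_zero).1 this
  have hρ : √k ^ 2 = k := Real.sq_sqrt hk.le
  have hslit : ∀ s ∈ Metric.ball (0 : ℂ) √k, 2 * (k : ℂ) + s ^ 2 ∈ slitPlane := by
    intro s hs
    rw [mem_ball_zero_iff] at hs
    have hre : |(s ^ 2).re| ≤ ‖s‖ ^ 2 := (Complex.abs_re_le_norm _).trans (norm_pow s 2).le
    have hre' := neg_abs_le (s ^ 2).re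
    have : ‖s‖ ^ 2 < k := by rw [← hρ]; gcongr
    refine Complex.mem_slitPlane_iff.2 (Or.inl ?_)
    simp only [Complex.add_re, Complex.mul_re, Complex.re_ofNat, Complex.im_ofNat,
      Complex.ofReal_re]
    linarith
  -- Substitute z' = ε(k + s²) in P + QR. The radius √k keeps the real part of 2k + s² positive, so
  -- its principal root is holomorphic.
  refine ⟨√k, fun s => -(m / (2 * k ^ 2) * (ε * (k + s ^ 2)) +
      n / (4 * (k ^ 2) ^ 2) * (2 * (ε * (k + s ^ 2)) ^ 2 - k ^ 2))
      + (m / (2 * k ^ 2) + n / (2 * (k ^ 2) ^ 2) * (ε * (k + s ^ 2))) *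
        (ε * (s * Complex.sqrt (2 * k + s ^ 2))), Real.sqrt_pos.2 hk, ?_, ?_, ?_⟩
  · have : DifferentiableOn ℂ (fun s : ℂ => Complex.sqrt (2 * k + s ^ 2))
        (Metric.ball 0 √k) := fun s hs =>
      ((Complex.hasDerivAt_sqrt (hslit s hs)).differentiableAt.comp s
        (f := fun s : ℂ => 2 * (k : ℂ) + s ^ 2) (by fun_prop)).differentiableWithinAt
    fun_prop
  · intro z hz hzs
    have hs := Complex.sqrt_re_pos hzs
    have hs2 := Complex.sqrt_sq_eq ((z - (r + ε * (k * e))) / (ε * e))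
    set s := Complex.sqrt ((z - (r + ε * (k * e))) / (ε * e))
    have hsn : ‖s‖ ^ 2 < k := by
      rw [← norm_pow, hs2, norm_div, norm_mul, hεn, he, one_mul, div_one]
      exact hz.trans_eq hρ
    obtain ⟨h0, hR⟩ := focalRoot_add_sq hs hsn
    have hz' : e⁻¹ * (z - r) = ε * (k + s ^ 2) := by
      rw [hs2]; field_simp; ring
    beta_reduce
    rw [hz', alignedPotential_eq (pow_ne_zero 2 hk0) (mul_ne_zero hε0 h0),
      focalRoot_mul_of_sq_eq_one hε, hR]
  -- The P part is even in s and the Q part odd, so an even h forces Q to vanish at every s ≠ 0.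
  · by_contra! hc
    have hQ : ∀ s ∈ Metric.ball (0 : ℂ) √k, s ≠ 0 →
        m / (2 * k ^ 2) + n / (2 * (k ^ 2) ^ 2) * (ε * (k + s ^ 2)) = 0 := by
      intro s hs hs0
      have h := hc s hs
      simp only [neg_sq] at h
      have hT : Complex.sqrt (2 * k + s ^ 2) ≠ 0 := fun h => by
        have := Complex.sqrt_re_pos (hslit s hs)
        simp [h] at this
      have h2 : (m / (2 * k ^ 2) + n / (2 * (k ^ 2) ^ 2) * (ε * (k + s ^ 2))) *
          (ε * (s * Complex.sqrt (2 * k + s ^ 2))) = 0 := by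
        linear_combination (-1 / 2 : ℂ) * h
      exact (mul_eq_zero.1 h2).resolve_right (by simp [hε0, hs0, hT])
    have hk2 : 0 < √k := Real.sqrt_pos.2 hk
    have hk2' : (√k : ℂ) ≠ 0 := by exact_mod_cast hk2.ne'
    -- Q is affine in s², so its vanishing at two distinct values, s² = k/4 and s² = k/9, suffices.
    have h1 := hQ (√k / 2 : ℝ) (by
      rw [mem_ball_zero_iff, Complex.norm_real, Real.norm_of_nonneg (by positivity)]; linarith)
      (by simp [hk2'])
    have h2 := hQ (√k / 3 : ℝ) (by
      rw [mem_ball_zero_iff, Complex.norm_real, Real.norm_of_nonneg (by positivity)]; linarith)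
      (by simp [hk2'])
    push_cast at h1 h2
    have hn : n = 0 := by
      have : n * (ε * (√k : ℂ) ^ 2) = 0 := by
        field_simp at h1 h2
        linear_combination (36 / 5 / 4 * h1 - 36 / 5 / 9 * h2)
      simpa [hε0, hk2'] using this
    have hm : m = 0 := by simpa [hn, hk0] using h1
    exact hmn.elim (· hm) (· hn)

/-! ### The Joukowsky map and the level sets of the ellipse. -/

/-- The quadratic form whose unit ball is `standardEllipse a b`. -/
noncomputable def ellipseLevel (a b : ℝ) (z : ℂ) : ℝ := (z.re / a) ^ 2 + (z.im / b) ^ 2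

theorem continuous_ellipseLevel (a b : ℝ) : Continuous (ellipseLevel a b) := by
  unfold ellipseLevel
  fun_prop

/-- The circle |ζ| = ρ is sent to an ellipse of semi-axes ((a + b)ρ ± (a - b)/ρ)/2. The level is the
average, with weights cos² and sin² of the argument of ζ, of the squared ratios of these semi-axes
to a and b; comparing it with 1 amounts to comparing each ratio with 1. -/
theorem ellipseLevel_joukowsky (a b : ℝ) {ζ : ℂ} (hζ : ζ ≠ 0) :
    ellipseLevel a b (joukowsky a b ζ) =
      (((a + b) * ‖ζ‖ ^ 2 + (a - b)) / (2 * a * ‖ζ‖)) ^ 2 * (ζ.re / ‖ζ‖) ^ 2 +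
      (((a + b) * ‖ζ‖ ^ 2 - (a - b)) / (2 * b * ‖ζ‖)) ^ 2 * (ζ.im / ‖ζ‖) ^ 2 := by
  have hn : ‖ζ‖ ≠ 0 := norm_ne_zero_iff.2 hζ
  have hre : (joukowsky a b ζ).re = ((a + b) * ‖ζ‖ ^ 2 + (a - b)) / 2 * ζ.re / ‖ζ‖ ^ 2 := by
    have : (joukowsky a b ζ).re = ((a + b) * ζ.re + (a - b) * ζ.re / Complex.normSq ζ) / 2 := by
      simp [joukowsky, Complex.div_re]
    rw [this, Complex.normSq_eq_norm_sq]
    field_simp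
  have him : (joukowsky a b ζ).im = ((a + b) * ‖ζ‖ ^ 2 - (a - b)) / 2 * ζ.im / ‖ζ‖ ^ 2 := by
    have : (joukowsky a b ζ).im = ((a + b) * ζ.im - (a - b) * ζ.im / Complex.normSq ζ) / 2 := by
      simp [joukowsky, Complex.div_im]
      ring
    rw [this, Complex.normSq_eq_norm_sq]
    field_simp
  rw [ellipseLevel, hre, him]
  congr 1 <;> rw [← mul_pow] <;> congr 1 <;> field_simp

theorem re_div_norm_sq_add {ζ : ℂ} (hζ : ζ ≠ 0) :
    (ζ.re / ‖ζ‖) ^ 2 + (ζ.im / ‖ζ‖) ^ 2 = 1 := by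
  have hn : ‖ζ‖ ≠ 0 := norm_ne_zero_iff.2 hζ
  have := Complex.normSq_eq_norm_sq ζ
  rw [Complex.normSq_apply] at this
  field_simp
  linarith

section Level
variable {a b : ℝ} (hb : 0 < b) (hab : b < a) {ζ : ℂ}
include hb hab

theorem one_lt_ellipseLevel_joukowsky (hζ : 1 < ‖ζ‖) :
    1 < ellipseLevel a b (joukowsky a b ζ) := by
  have hζ0 : ζ ≠ 0 := by rintro rfl; norm_num at hζ
  rw [ellipseLevel_joukowsky a b hζ0]
  have h := re_div_norm_sq_add hζ0
  have h1 : 1 < (((a + b) * ‖ζ‖ ^ 2 + (a - b)) / (2 * a * ‖ζ‖)) ^ 2 := by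
    refine one_lt_pow₀ ((one_lt_div (by nlinarith)).2 ?_) two_ne_zero
    have : 0 < (‖ζ‖ - 1) * ((a + b) * ‖ζ‖ - (a - b)) := mul_pos (by linarith) (by nlinarith)
    linarith
  have h2 : 1 < (((a + b) * ‖ζ‖ ^ 2 - (a - b)) / (2 * b * ‖ζ‖)) ^ 2 := by
    refine one_lt_pow₀ ((one_lt_div (by nlinarith)).2 ?_) two_ne_zero
    have : 0 < (‖ζ‖ - 1) * ((a + b) * ‖ζ‖ + (a - b)) := mul_pos (by linarith) (by nlinarith)
    linarith
  rcases (sq_nonneg (ζ.re / ‖ζ‖)).eq_or_lt with h3 | h3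
  · rw [← h3] at h ⊢; nlinarith
  · nlinarith [sq_nonneg (ζ.im / ‖ζ‖)]

theorem ellipseLevel_joukowsky_eq_one (hζ : ‖ζ‖ = 1) :
    ellipseLevel a b (joukowsky a b ζ) = 1 := by
  have hζ0 : ζ ≠ 0 := by rintro rfl; norm_num at hζ
  have ha : a ≠ 0 := by linarith
  rw [ellipseLevel_joukowsky a b hζ0, ← re_div_norm_sq_add hζ0, hζ]
  field_simp
  ring

/-- The lower bound on |ζ| matters: inside the critical circle |ζ|² = (a - b)/(a + b) the map covers
the plane a second time and the level grows again. -/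
theorem ellipseLevel_joukowsky_lt_one (hζ : a - b ≤ (a + b) * ‖ζ‖ ^ 2) (hζ1 : ‖ζ‖ < 1) :
    ellipseLevel a b (joukowsky a b ζ) < 1 := by
  have hζ0 : ζ ≠ 0 := by rintro rfl; norm_num at hζ; linarith
  have hn : 0 < ‖ζ‖ := norm_pos_iff.2 hζ0
  have hn2 : ‖ζ‖ ^ 2 < ‖ζ‖ := by nlinarith
  rw [ellipseLevel_joukowsky a b hζ0]
  have h := re_div_norm_sq_add hζ0
  have hs : (a + b) * ‖ζ‖ ^ 2 < (a + b) * ‖ζ‖ := mul_lt_mul_of_pos_left hn2 (by linarith)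
  have ha : 0 < a := hb.trans hab
  have h1 : (((a + b) * ‖ζ‖ ^ 2 + (a - b)) / (2 * a * ‖ζ‖)) ^ 2 < 1 := by
    refine pow_lt_one₀ (div_nonneg (by nlinarith) (by positivity))
      ((div_lt_one (by positivity)).2 ?_) two_ne_zero
    have : 0 < (1 - ‖ζ‖) * ((a + b) * ‖ζ‖ - (a - b)) := mul_pos (by linarith) (by linarith)
    linarith
  have h2 : (((a + b) * ‖ζ‖ ^ 2 - (a - b)) / (2 * b * ‖ζ‖)) ^ 2 < 1 := by
    refine pow_lt_one₀ (div_nonneg (by linarith) (by positivity))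
      ((div_lt_one (by positivity)).2 ?_) two_ne_zero
    have : 0 < (1 - ‖ζ‖) * ((a + b) * ‖ζ‖ + (a - b)) := mul_pos (by linarith) (by nlinarith)
    linarith
  rcases (sq_nonneg (ζ.re / ‖ζ‖)).eq_or_lt with h3 | h3
  · rw [← h3] at h ⊢; nlinarith
  · nlinarith [sq_nonneg (ζ.im / ‖ζ‖)]

/-- The equation is quadratic in ζ and its two roots have product (a - b)/(a + b), so they cannot
both lie strictly inside the critical circle. -/
theorem exists_joukowsky_eq (z : ℂ) :
    ∃ ζ, joukowsky a b ζ = z ∧ a - b ≤ (a + b) * ‖ζ‖ ^ 2 := by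
  have hs : (0 : ℝ) < a + b := by linarith
  have hs' : (a : ℂ) + b ≠ 0 := by exact_mod_cast hs.ne'
  have hd' : (a : ℂ) - b ≠ 0 := by exact_mod_cast (sub_pos.2 hab).ne'
  obtain ⟨w, hw⟩ : ∃ w : ℂ, w ^ 2 = z ^ 2 - (a ^ 2 - b ^ 2) := ⟨_, Complex.sqrt_sq_eq _⟩
  set ζ₁ := (z + w) / (a + b) with h1
  set ζ₂ := (z - w) / (a + b) with h2
  have hprod : ζ₁ * ζ₂ = (a - b) / (a + b) := by
    rw [h1, h2]; field_simp; linear_combination -hw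
  have hJ : ∀ ζ η : ℂ, ζ * η = (a - b) / (a + b) → (a + b) * (ζ + η) = 2 * z →
      joukowsky a b ζ = z := by
    intro ζ η hm hadd
    have h0 : ζ ≠ 0 := by
      rintro rfl
      rw [zero_mul, eq_comm, div_eq_zero_iff] at hm
      exact hm.elim hd' hs'
    have : ((a : ℂ) - b) / ζ = (a + b) * η := by
      rw [div_eq_iff h0]; rw [eq_div_iff hs'] at hm; linear_combination -hm
    rw [joukowsky, this]
    linear_combination hadd / 2
  have hadd : (a + b) * (ζ₁ + ζ₂) = 2 * z := by rw [h1, h2]; field_simp; ring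
  by_contra! hc
  have hc1 := hc ζ₁ (hJ _ _ hprod hadd)
  have hc2 := hc ζ₂ (hJ _ _ (by rw [mul_comm, hprod]) (by rw [add_comm ζ₂, hadd]))
  have hn := congrArg norm hprod
  rw [norm_mul, ← Complex.ofReal_sub, ← Complex.ofReal_add, ← Complex.ofReal_div,
    Complex.norm_real, Real.norm_of_nonneg (div_nonneg (by linarith) hs.le),
    eq_div_iff hs.ne'] at hn
  have h3 := mul_lt_mul'' hc1 hc2 (by positivity) (by positivity)
  have : (a + b) * ‖ζ₁‖ ^ 2 * ((a + b) * ‖ζ₂‖ ^ 2) = (a - b) * (a - b) := by rw [← hn]; ring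
  linarith

end Level

/-! ### The placed ellipse and its exterior. -/

/-- The ellipse of semi-axes `a`, `b`, of centre `r` and orientation `α`. -/
noncomputable def placedEllipse (a b α : ℝ) (r : ℂ) : Set ℂ :=
  Placement.solid ⟨α, 0, r⟩ (standardEllipse a b)

/-- The conformal map from the exterior of the unit disc to the exterior of `placedEllipse`. -/
noncomputable def ellipseMap (a b α : ℝ) (r ζ : ℂ) : ℂ :=
  Complex.exp (α * Complex.I) * joukowsky a b ζ + r

theorem exp_neg_mul_ellipseMap_sub (a b α : ℝ) (r ζ : ℂ) :
    Complex.exp (-(α * Complex.I)) * (ellipseMap a b α r ζ - r) = joukowsky a b ζ := by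
  rw [ellipseMap, Complex.exp_neg]
  have := Complex.exp_ne_zero (α * Complex.I)
  field_simp
  ring

theorem ellipseMap_eq_of_joukowsky_eq {a b α : ℝ} {r ζ z : ℂ}
    (h : joukowsky a b ζ = Complex.exp (-(α * Complex.I)) * (z - r)) :
    ellipseMap a b α r ζ = z := by
  rw [ellipseMap, h, Complex.exp_neg]
  have := Complex.exp_ne_zero (α * Complex.I)
  field_simp
  ring

theorem mem_placedEllipse {a b α : ℝ} {r z : ℂ} : z ∈ placedEllipse a b α r ↔
    ellipseLevel a b (Complex.exp (-(α * Complex.I)) * (z - r)) ≤ 1 := by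
  have := Complex.exp_ne_zero (α * Complex.I)
  constructor
  · rintro ⟨x, hx, rfl⟩
    have : Complex.exp (-(α * Complex.I)) * (Placement.map ⟨α, 0, r⟩ x - r) = x := by
      simp only [Placement.map]
      rw [Complex.exp_neg]; field_simp; ring
    rw [this]
    exact hx
  · intro h
    refine ⟨_, h, ?_⟩
    simp only [Placement.map]
    rw [Complex.exp_neg]; field_simp; ring

theorem continuous_ellipseLevel_comp (a b α : ℝ) (r : ℂ) : Continuous fun z =>
    ellipseLevel a b (Complex.exp (-(α * Complex.I)) * (z - r)) :=
  (continuous_ellipseLevel a b).comp (by fun_prop)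

theorem isClosed_placedEllipse (a b α : ℝ) (r : ℂ) : IsClosed (placedEllipse a b α r) := by
  have : placedEllipse a b α r =
      {z | ellipseLevel a b (Complex.exp (-(α * Complex.I)) * (z - r)) ≤ 1} := by
    ext z; exact mem_placedEllipse
  rw [this]
  exact isClosed_le (continuous_ellipseLevel_comp a b α r) continuous_const

theorem isOpen_fluidDomain (S : Set ℂ) : IsOpen (fluidDomain S) := isClosed_closure.isOpen_compl

theorem mem_fluidDomain_placedEllipse {a b α : ℝ} {r z : ℂ} :
    z ∈ fluidDomain (placedEllipse a b α r) ↔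
      1 < ellipseLevel a b (Complex.exp (-(α * Complex.I)) * (z - r)) := by
  rw [fluidDomain, (isClosed_placedEllipse a b α r).closure_eq, mem_compl_iff, mem_placedEllipse,
    not_le]

theorem one_le_of_mem_closure_fluidDomain {a b α : ℝ} {r z : ℂ}
    (hz : z ∈ closure (fluidDomain (placedEllipse a b α r))) :
    1 ≤ ellipseLevel a b (Complex.exp (-(α * Complex.I)) * (z - r)) :=
  closure_minimal (fun _ h => (mem_fluidDomain_placedEllipse.1 h).le)
    (isClosed_le continuous_const (continuous_ellipseLevel_comp a b α r)) hz

theorem ellipseLevel_eq_one_of_mem_frontier {a b α : ℝ} {r z : ℂ}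
    (hz : z ∈ frontier (placedEllipse a b α r)) :
    ellipseLevel a b (Complex.exp (-(α * Complex.I)) * (z - r)) = 1 := by
  refine le_antisymm (mem_placedEllipse.1 ((isClosed_placedEllipse a b α r).frontier_subset hz)) ?_
  rw [frontier_eq_closure_inter_closure, inter_comm] at hz
  refine one_le_of_mem_closure_fluidDomain ?_
  rw [fluidDomain, (isClosed_placedEllipse a b α r).closure_eq]
  exact hz.1

section Exterior
variable {a b : ℝ} (hb : 0 < b) (hab : b < a) {α : ℝ} {r : ℂ}
include hb hab

theorem ellipseMap_mem_fluidDomain {ζ : ℂ} (hζ : 1 < ‖ζ‖) :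
    ellipseMap a b α r ζ ∈ fluidDomain (placedEllipse a b α r) := by
  rw [mem_fluidDomain_placedEllipse, exp_neg_mul_ellipseMap_sub]
  exact one_lt_ellipseLevel_joukowsky hb hab hζ

/-- Among preimages on or outside the critical circle, the level exceeds 1 only if |ζ| > 1. -/
theorem exists_ellipseMap_eq_of_mem_fluidDomain {z : ℂ}
    (hz : z ∈ fluidDomain (placedEllipse a b α r)) :
    ∃ ζ, 1 < ‖ζ‖ ∧ ellipseMap a b α r ζ = z := by
  rw [mem_fluidDomain_placedEllipse] at hz
  obtain ⟨ζ, h, hζ⟩ := exists_joukowsky_eq hb hab (Complex.exp (-(α * Complex.I)) * (z - r))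
  refine ⟨ζ, ?_, ellipseMap_eq_of_joukowsky_eq h⟩
  by_contra! hc
  rw [← h] at hz
  rcases hc.eq_or_lt with h1 | h1
  · exact hz.ne' (ellipseLevel_joukowsky_eq_one hb hab h1)
  · exact hz.not_gt (ellipseLevel_joukowsky_lt_one hb hab hζ h1)

theorem exists_ellipseMap_eq_of_mem_frontier {z : ℂ}
    (hz : z ∈ frontier (placedEllipse a b α r)) :
    ∃ ζ, ‖ζ‖ = 1 ∧ ellipseMap a b α r ζ = z := by
  have hz := ellipseLevel_eq_one_of_mem_frontier hz
  obtain ⟨ζ, h, hζ⟩ := exists_joukowsky_eq hb hab (Complex.exp (-(α * Complex.I)) * (z - r))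
  refine ⟨ζ, ?_, ellipseMap_eq_of_joukowsky_eq h⟩
  rw [← h] at hz
  rcases lt_trichotomy ‖ζ‖ 1 with h1 | h1 | h1
  · exact absurd hz (ellipseLevel_joukowsky_lt_one hb hab hζ h1).ne
  · exact h1
  · exact absurd hz (one_lt_ellipseLevel_joukowsky hb hab h1).ne'

omit hb hab in
theorem hasDerivAt_ellipseMap (a b α : ℝ) (r : ℂ) {ζ : ℂ} (hζ : ζ ≠ 0) :
    HasDerivAt (ellipseMap a b α r)
      (Complex.exp (α * Complex.I) * joukowskyNormal a b ζ / ζ) ζ := by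
  have h : HasDerivAt (ellipseMap a b α r)
      (Complex.exp (α * Complex.I) * (((a + b) * 1 + (a - b) * (-(ζ ^ 2)⁻¹)) / 2)) ζ := by
    unfold ellipseMap joukowsky
    simp only [div_eq_mul_inv ((a : ℂ) - b)]
    exact (((((hasDerivAt_id ζ).const_mul _).add ((hasDerivAt_inv hζ).const_mul _)).div_const
      2).const_mul _).add_const r
  convert h using 1
  rw [joukowskyNormal]
  field_simp
  ring

theorem ellipseMap_mem_closure_fluidDomain {ζ : ℂ} (hζ : 1 ≤ ‖ζ‖) :
    ellipseMap a b α r ζ ∈ closure (fluidDomain (placedEllipse a b α r)) := by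
  have hζ0 : ζ ≠ 0 := by rintro rfl; norm_num at hζ
  -- The point is approached along the ray tζ, t ↓ 1, whose image lies in the fluid.
  have hc : ContinuousAt (fun t : ℝ => ellipseMap a b α r (t * ζ)) 1 := by
    have h1 : ContinuousAt (ellipseMap a b α r) (((1 : ℝ) : ℂ) * ζ) := by
      simpa using (hasDerivAt_ellipseMap a b α r hζ0).continuousAt
    exact ContinuousAt.comp (f := fun t : ℝ => (t : ℂ) * ζ) h1 (by fun_prop)
  have h2 := hc.tendsto.mono_left (nhdsWithin_le_nhds (s := Ioi 1))
  simp only [Complex.ofReal_one, one_mul] at h2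
  refine mem_closure_of_tendsto h2 ?_
  filter_upwards [self_mem_nhdsWithin] with t ht
  refine ellipseMap_mem_fluidDomain hb hab ?_
  have ht : 1 < t := ht
  rw [norm_mul, Complex.norm_real, Real.norm_of_nonneg (by linarith)]
  nlinarith

theorem ellipseMap_mem_frontier {ζ : ℂ} (hζ : ‖ζ‖ = 1) :
    ellipseMap a b α r ζ ∈ frontier (placedEllipse a b α r) := by
  rw [frontier_eq_closure_inter_closure]
  constructor
  · apply subset_closure
    rw [mem_placedEllipse, exp_neg_mul_ellipseMap_sub, ellipseLevel_joukowsky_eq_one hb hab hζ]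
  · have := ellipseMap_mem_closure_fluidDomain hb hab (α := α) (r := r) hζ.ge
    rwa [fluidDomain, (isClosed_placedEllipse a b α r).closure_eq] at this

/-! ### Tangents and normals of the boundary. -/

omit hb hab in
theorem norm_exp_mul_I_eq_one (α : ℝ) : ‖Complex.exp (α * Complex.I)‖ = 1 :=
  Complex.norm_exp_ofReal_mul_I α

/-- The real direction `i N` is tangent to the ellipse. -/
theorem tangent_mem_tangentConeAt {ζ : ℂ} (hζ : ‖ζ‖ = 1) :
    Complex.I * (Complex.exp (α * Complex.I) * joukowskyNormal a b ζ) ∈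
      tangentConeAt ℝ (frontier (placedEllipse a b α r)) (ellipseMap a b α r ζ) := by
  have hζ0 : ζ ≠ 0 := by rintro rfl; norm_num at hζ
  -- The image of t ↦ ζe^{it} is a curve in the boundary with velocity iN at t = 0.
  have h1 : HasDerivAt (fun t : ℝ => ζ * Complex.exp (t * Complex.I)) (ζ * Complex.I) 0 := by
    have h := ((hasDerivAt_id (0 : ℂ)).mul_const Complex.I).cexp.const_mul ζ
    have h' := HasDerivAt.comp_ofReal (z := 0) (by simpa using h)
    simpa using h'
  have h2 : HasDerivAt (fun t : ℝ => ellipseMap a b α r (ζ * Complex.exp (t * Complex.I)))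
      (Complex.exp (α * Complex.I) * joukowskyNormal a b ζ / ζ * (ζ * Complex.I)) 0 := by
    refine HasDerivAt.comp (0 : ℝ) (h₂ := ellipseMap a b α r)
      (h := fun t : ℝ => ζ * Complex.exp (t * Complex.I)) ?_ h1
    simpa using hasDerivAt_ellipseMap a b α r hζ0
  have h3 := (h2.hasFDerivAt.hasFDerivWithinAt (s := univ)).mapsTo_tangent_cone
    (by rw [tangentConeAt_univ]; exact mem_univ (1 : ℝ))
  simp only [Complex.ofReal_zero, zero_mul, Complex.exp_zero, mul_one] at h3
  have hsub : (fun t : ℝ => ellipseMap a b α r (ζ * Complex.exp (t * Complex.I))) '' univ ⊆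
      frontier (placedEllipse a b α r) := by
    rintro _ ⟨t, -, rfl⟩
    refine ellipseMap_mem_frontier hb hab ?_
    rw [norm_mul, hζ, Complex.norm_exp_ofReal_mul_I, one_mul]
  convert tangentConeAt_mono hsub h3 using 1
  rw [ContinuousLinearMap.toSpanSingleton_apply, one_smul]
  field_simp

omit hb hab in
theorem joukowsky_of_norm_eq_one (a b : ℝ) {ζ : ℂ} (hζ : ‖ζ‖ = 1) :
    joukowsky a b ζ = ⟨a * ζ.re, b * ζ.im⟩ ∧ joukowskyNormal a b ζ = ⟨b * ζ.re, a * ζ.im⟩ := by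
  rw [joukowsky, joukowskyNormal, div_eq_mul_inv _ ζ, Complex.inv_eq_conj hζ]
  constructor <;> apply Complex.ext <;> simp <;> ring

/-- The level function is constant on the boundary, so its derivative vanishes on the tangent cone,
and its gradient at this point is a real multiple of N. -/
theorem inner_normal_of_mem_tangentConeAt {ζ : ℂ} (hζ : ‖ζ‖ = 1) {τ : ℂ}
    (hτ : τ ∈ tangentConeAt ℝ (frontier (placedEllipse a b α r)) (ellipseMap a b α r ζ)) :
    inner ℝ τ (Complex.exp (α * Complex.I) * joukowskyNormal a b ζ) = 0 := by
  have ha : a ≠ 0 := by linarith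
  obtain ⟨hJ, hN⟩ := joukowsky_of_norm_eq_one a b hζ
  set e := Complex.exp (-(α * Complex.I)) with he
  set x := ellipseMap a b α r ζ with hx
  have hlin : HasFDerivAt (fun z : ℂ => e * (z - r))
      ((ContinuousLinearMap.mul ℝ ℂ) e) x :=
    ((ContinuousLinearMap.mul ℝ ℂ) e).hasFDerivAt.comp x ((hasFDerivAt_id x).sub_const r)
  have hre := (Complex.reCLM.hasFDerivAt.comp x hlin).mul_const a⁻¹ |>.pow 2
  have him := (Complex.imCLM.hasFDerivAt.comp x hlin).mul_const b⁻¹ |>.pow 2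
  have hG := (hre.add him).hasFDerivWithinAt (s := frontier (placedEllipse a b α r))
  have hconst := (hasFDerivWithinAt_const (1 : ℝ) x (frontier (placedEllipse a b α r))
    (𝕜 := ℝ)).congr (f₁ := fun z : ℂ => ellipseLevel a b (e * (z - r)))
    (fun z hz => ellipseLevel_eq_one_of_mem_frontier hz)
    (ellipseLevel_eq_one_of_mem_frontier (ellipseMap_mem_frontier hb hab hζ))
  have heq := HasFDerivWithinAt.unique_on hconst hG hτ
  have hxr : e * (x - r) = ⟨a * ζ.re, b * ζ.im⟩ := by
    rw [← hJ]; exact exp_neg_mul_ellipseMap_sub a b α r ζ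
  simp [hxr] at heq
  have hinner : inner ℝ τ (Complex.exp (α * Complex.I) * joukowskyNormal a b ζ) =
      inner ℝ (e * τ) (joukowskyNormal a b ζ) := by
    rw [Complex.inner, Complex.inner, map_mul, he, ← Complex.exp_conj]
    simp
    ring
  rw [hinner, hN, Complex.inner]
  simp
  field_simp at heq
  linarith

theorem joukowskyNormal_ne_zero {ζ : ℂ} (hζ : ‖ζ‖ = 1) : joukowskyNormal a b ζ ≠ 0 := by
  have hζ0 : ζ ≠ 0 := by rintro rfl; norm_num at hζ
  intro h
  have h1 : ((a : ℂ) + b) * ζ ^ 2 = a - b := by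
    rw [joukowskyNormal] at h
    field_simp at h
    linear_combination h
  have h2 := congrArg norm h1
  rw [norm_mul, norm_pow, hζ, ← Complex.ofReal_sub, ← Complex.ofReal_add, Complex.norm_real,
    Complex.norm_real, Real.norm_of_nonneg (by linarith), Real.norm_of_nonneg (by linarith)] at h2
  linarith

/-- The tangent cone contains iN and is orthogonal to N, so the unit normals are exactly ±N/|N|, and
the slip condition reduces to one scalar equation on the unit circle. -/
theorem forall_isUnitNormal_inner_eq_iff {ζ : ℂ} (hζ : ‖ζ‖ = 1) (u v : ℂ) :
    (∀ n, IsUnitNormal (placedEllipse a b α r) (ellipseMap a b α r ζ) n →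
      inner ℝ u n = inner ℝ v n) ↔
    (conj u * (Complex.exp (α * Complex.I) * joukowskyNormal a b ζ)).re =
      (conj v * (Complex.exp (α * Complex.I) * joukowskyNormal a b ζ)).re := by
  have hN0 : Complex.exp (α * Complex.I) * joukowskyNormal a b ζ ≠ 0 :=
    mul_ne_zero (Complex.exp_ne_zero _) (joukowskyNormal_ne_zero hb hab hζ)
  have htan := tangent_mem_tangentConeAt hb hab (α := α) (r := r) hζ
  have hnor := fun τ hτ => inner_normal_of_mem_tangentConeAt hb hab (α := α) (r := r) hζ (τ := τ) hτ
  set N := Complex.exp (α * Complex.I) * joukowskyNormal a b ζ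
  have hsmul : ∀ (t : ℝ) (w : ℂ), inner ℝ w (t * N) = t * (conj w * N).re := by
    intro t w
    rw [← Complex.real_smul, inner_smul_right, Complex.inner, mul_comm N]
  constructor
  · intro h
    have hn := norm_pos_iff.2 hN0
    have := h ((‖N‖⁻¹ : ℝ) * N) ⟨by
      rw [norm_mul, Complex.norm_real, norm_inv, norm_norm, inv_mul_cancel₀ hn.ne'], fun τ hτ => by
      rw [hsmul, mul_comm (conj τ), ← Complex.inner, hnor τ hτ, mul_zero]⟩
    rw [hsmul, hsmul] at this
    exact mul_left_cancel₀ (inv_ne_zero hn.ne') this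
  · intro h n hn
    have h1 := hn.2 _ htan
    have h2 : n = ((conj N * n).re / Complex.normSq N : ℝ) * N := by
      have h3 : (conj N * n).im = 0 := by
        rw [Complex.inner] at h1
        simp at h1 ⊢
        linarith
      have h4 : conj N * n = ((conj N * n).re : ℂ) := Complex.ext (by simp) (by simp [h3])
      have h5 : (Complex.normSq N : ℂ) ≠ 0 := by exact_mod_cast (Complex.normSq_pos.2 hN0).ne'
      rw [Complex.ofReal_div, ← h4, div_mul_eq_mul_div, eq_div_iff h5, ← Complex.mul_conj]
      ring
    rw [h2, hsmul, hsmul, h]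

end Exterior

/-! ### Existence of the potential and the limits at infinity. -/

/-- Cauchy's estimate on discs of radius 1 far from the origin. -/
theorem tendsto_deriv_cocompact_of_tendsto {f : ℂ → ℂ} {K : Set ℂ} (hK : IsCompact K)
    (hf : ∀ z ∉ K, DifferentiableAt ℂ f z) (h0 : Tendsto f (cocompact ℂ) (𝓝 0)) :
    Tendsto (deriv f) (cocompact ℂ) (𝓝 0) := by
  rw [Metric.tendsto_nhds]
  intro ε hε
  have h1 : ∀ᶠ z in cocompact ℂ, ‖f z‖ < ε / 2 ∧ z ∉ K := by
    filter_upwards [Metric.tendsto_nhds.1 h0 (ε / 2) (by positivity), hK.compl_mem_cocompact]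
      with z hz hzK
    exact ⟨by simpa using hz, hzK⟩
  rw [← Metric.cobounded_eq_cocompact, (Metric.hasBasis_cobounded_compl_closedBall 0).eventually_iff]
    at h1 ⊢
  obtain ⟨M, -, hM⟩ := h1
  refine ⟨M + 1, trivial, fun z hz => ?_⟩
  have hball : ∀ y ∈ Metric.closedBall z 1, ‖f y‖ < ε / 2 ∧ y ∉ K := by
    intro y hy
    refine hM ?_
    simp only [mem_compl_iff, mem_closedBall_iff_norm, sub_zero, not_le] at hz hy ⊢
    have := norm_sub_norm_le z y
    rw [norm_sub_rev] at this
    linarith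
  have hd : DiffContOnCl ℂ f (Metric.ball z 1) := by
    refine DifferentiableOn.diffContOnCl fun y hy => ?_
    exact (hf y (hball y (Metric.closure_ball_subset_closedBall hy)).2).differentiableWithinAt
  have := Complex.norm_deriv_le_of_forall_mem_sphere_norm_le one_pos hd
    (fun y hy => (hball y (Metric.sphere_subset_closedBall hy)).1.le)
  rw [dist_zero_right]
  linarith

theorem tendsto_rotate_cocompact (α : ℝ) (r : ℂ) :
    Tendsto (fun z => Complex.exp (-(α * Complex.I)) * (z - r)) (cocompact ℂ) (cocompact ℂ) :=
  ((Homeomorph.subRight r).trans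
    (Homeomorph.mulLeft₀ _ (Complex.exp_ne_zero (-(α * Complex.I))))).isClosedEmbedding.tendsto_cocompact

/-- The segment joining the foci, in the frame of the ellipse. -/
theorem mem_segment_of_rotate_mem {k : ℝ} (hk : 0 < k) {α : ℝ} {r z : ℂ}
    (hz : Complex.exp (-(α * Complex.I)) * (z - r) ∈ Complex.ofReal '' Icc (-k) k) :
    z ∈ segment ℝ (r - k * Complex.exp (α * Complex.I)) (r + k * Complex.exp (α * Complex.I)) := by
  obtain ⟨x, hx, hxz⟩ := hz
  have he := Complex.exp_ne_zero (α * Complex.I)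
  have hk' : (k : ℂ) ≠ 0 := by exact_mod_cast hk.ne'
  have hz' : z = r + x * Complex.exp (α * Complex.I) := by
    rw [hxz, Complex.exp_neg]; field_simp; ring
  refine ⟨(k - x) / (2 * k), (k + x) / (2 * k), div_nonneg (by linarith [hx.2]) (by linarith),
    div_nonneg (by linarith [hx.1]) (by linarith), by field_simp; ring, ?_⟩
  rw [hz', Complex.real_smul, Complex.real_smul]
  push_cast
  field_simp
  ring

theorem isCompact_rotate_preimage_image (α : ℝ) (r : ℂ) (k : ℝ) :
    IsCompact ((fun z => Complex.exp (-(α * Complex.I)) * (z - r)) ⁻¹'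
      (Complex.ofReal '' Icc (-k) k)) :=
  ((Homeomorph.subRight r).trans
    (Homeomorph.mulLeft₀ _ (Complex.exp_ne_zero (-(α * Complex.I))))).isCompact_preimage.2
    (isCompact_Icc.image Complex.continuous_ofReal)

section
variable {a b : ℝ} (hb : 0 < b) (hab : b < a)
include hb hab

theorem focal_pos : 0 < √(a ^ 2 - b ^ 2) := Real.sqrt_pos.2 (by nlinarith)

theorem focal_sq : (√(a ^ 2 - b ^ 2) : ℂ) ^ 2 = (a : ℂ) ^ 2 - b ^ 2 := by
  have : √(a ^ 2 - b ^ 2) ^ 2 = a ^ 2 - b ^ 2 := Real.sq_sqrt (by nlinarith)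
  exact_mod_cast this

theorem ellipseLevel_lt_one_of_mem_image {z : ℂ}
    (hz : z ∈ Complex.ofReal '' Icc (-√(a ^ 2 - b ^ 2)) √(a ^ 2 - b ^ 2)) :
    ellipseLevel a b z < 1 := by
  obtain ⟨x, hx, rfl⟩ := hz
  have h1 : x ^ 2 ≤ a ^ 2 - b ^ 2 := by
    have := sq_le_sq' hx.1 hx.2
    rwa [Real.sq_sqrt (by nlinarith)] at this
  have ha : 0 < a := hb.trans hab
  simp only [ellipseLevel, Complex.ofReal_re, Complex.ofReal_im, zero_div, div_pow]
  rw [zero_pow two_ne_zero, add_zero, div_lt_one (by positivity)]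
  nlinarith

variable (α : ℝ) (r : ℂ) (ω : ℝ) (w₀ : ℂ)

theorem differentiableAt_ellipsePotential {z : ℂ} (hz : Complex.exp (-(α * Complex.I)) * (z - r) ∉
      Complex.ofReal '' Icc (-√(a ^ 2 - b ^ 2)) √(a ^ 2 - b ^ 2)) :
    DifferentiableAt ℂ (ellipsePotential a b α r ω w₀) z := by
  rw [show ellipsePotential a b α r ω w₀ = _ from funext (ellipsePotential_eq a b α r ω w₀),
    ← focal_sq hb hab]
  exact (differentiableAt_alignedPotential (focal_pos hb hab) hz _ _).comp z
    (f := fun z => Complex.exp (-(α * Complex.I)) * (z - r)) (by fun_prop)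

theorem ellipsePotential_ellipseMap {ζ : ℂ} (hζ : a - b < (a + b) * ‖ζ‖ ^ 2) :
    ellipsePotential a b α r ω w₀ (ellipseMap a b α r ζ) =
      -(((a + b) * w₀ - (a - b) * conj w₀) / 2 / ζ
        + Complex.I * (a ^ 2 - b ^ 2) * ω / 4 / ζ ^ 2) := by
  have hs' : (a : ℂ) + b ≠ 0 := by exact_mod_cast (by linarith : (a + b : ℝ) ≠ 0)
  have hζ0 : ζ ≠ 0 := by rintro rfl; norm_num at hζ; linarith
  rw [ellipsePotential_eq, exp_neg_mul_ellipseMap_sub, alignedPotential_joukowsky hb hab hζ]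
  field_simp
  ring

/-- Since N is ζ times the derivative of the conformal map, the left side is ζ d/dζ of a polynomial
in 1/ζ, and 1/ζ = conj ζ on the circle. -/
theorem deriv_ellipsePotential_mul_normal {ζ : ℂ} (hζ : ‖ζ‖ = 1) :
    deriv (ellipsePotential a b α r ω w₀) (ellipseMap a b α r ζ) *
      (Complex.exp (α * Complex.I) * joukowskyNormal a b ζ) =
    ((a + b) * w₀ - (a - b) * conj w₀) / 2 * conj ζ
        + Complex.I * (a ^ 2 - b ^ 2) * ω / 2 * conj ζ ^ 2 := by
  have hζ0 : ζ ≠ 0 := by rintro rfl; norm_num at hζ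
  have hd : DifferentiableAt ℂ (ellipsePotential a b α r ω w₀) (ellipseMap a b α r ζ) := by
    refine differentiableAt_ellipsePotential hb hab α r ω w₀ fun h => ?_
    have := ellipseLevel_lt_one_of_mem_image hb hab h
    rw [exp_neg_mul_ellipseMap_sub, ellipseLevel_joukowsky_eq_one hb hab hζ] at this
    exact this.false
  have h1 := hd.hasDerivAt.comp ζ (hasDerivAt_ellipseMap a b α r hζ0)
  have h2 : HasDerivAt (fun ζ : ℂ => -(((a + b) * w₀ - (a - b) * conj w₀) / 2 * ζ⁻¹
        + Complex.I * (a ^ 2 - b ^ 2) * ω / 4 * ζ⁻¹ ^ 2)) _ ζ :=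
    (((hasDerivAt_inv hζ0).const_mul _).add (((hasDerivAt_inv hζ0).pow 2).const_mul _)).neg
  have h3 : ellipsePotential a b α r ω w₀ ∘ ellipseMap a b α r =ᶠ[𝓝 ζ]
      (fun ζ : ℂ => -(((a + b) * w₀ - (a - b) * conj w₀) / 2 * ζ⁻¹
        + Complex.I * (a ^ 2 - b ^ 2) * ω / 4 * ζ⁻¹ ^ 2)) := by
    have : ∀ᶠ η in 𝓝 ζ, a - b < (a + b) * ‖η‖ ^ 2 := by
      refine ContinuousAt.eventually_lt (by fun_prop) (by fun_prop) ?_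
      rw [hζ]; linarith
    filter_upwards [this] with η hη
    rw [Function.comp_apply, ellipsePotential_ellipseMap hb hab α r ω w₀ hη]
    simp [div_eq_mul_inv]
  have h4 := h1.unique (h2.congr_of_eventuallyEq h3)
  rw [← Complex.inv_eq_conj hζ]
  rw [mul_div_assoc', div_eq_iff hζ0] at h4
  rw [h4, show 2 - 1 = 1 from rfl, pow_one]
  push_cast
  field_simp
  ring

theorem isComplexPotential_ellipsePotential :
    IsComplexPotential (placedEllipse a b α r) ⟨ω, r, Complex.exp (α * Complex.I) * w₀⟩
      (ellipsePotential a b α r ω w₀) := by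
  set K := ((fun z => Complex.exp (-(α * Complex.I)) * (z - r)) ⁻¹'
      (Complex.ofReal '' Icc (-√(a ^ 2 - b ^ 2)) √(a ^ 2 - b ^ 2)))
  have hK : IsCompact K := isCompact_rotate_preimage_image α r _
  have hdiff : ∀ z ∉ K, DifferentiableAt ℂ (ellipsePotential a b α r ω w₀) z :=
    fun z hz => differentiableAt_ellipsePotential hb hab α r ω w₀ hz
  have hKS : ∀ z ∈ closure (fluidDomain (placedEllipse a b α r)), z ∉ K := fun z hz hzK =>
    (one_le_of_mem_closure_fluidDomain hz).not_gt (ellipseLevel_lt_one_of_mem_image hb hab hzK)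
  have hdecay : Tendsto (ellipsePotential a b α r ω w₀) (cocompact ℂ) (𝓝 0) := by
    rw [show ellipsePotential a b α r ω w₀ = _ from funext (ellipsePotential_eq a b α r ω w₀)]
    exact (tendsto_alignedPotential _ _ _).comp (tendsto_rotate_cocompact α r)
  -- The segment of foci is strictly inside the ellipse, so the fluid velocity itself serves as its
  -- continuous extension to the boundary.
  refine ⟨fun z hz => (hdiff z (hKS z (subset_closure hz))).differentiableWithinAt, hdecay, ?_,
    fluidVelocity (ellipsePotential a b α r ω w₀), ?_, fun _ _ => rfl, ?_⟩
  · have := (Complex.continuous_conj.tendsto 0).comp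
      (tendsto_deriv_cocompact_of_tendsto hK hdiff hdecay)
    rwa [map_zero] at this
  · have h1 : DifferentiableOn ℂ (ellipsePotential a b α r ω w₀) Kᶜ :=
      fun z hz => (hdiff z hz).differentiableWithinAt
    have h2 := (h1.deriv hK.isClosed.isOpen_compl).continuousOn
    exact Complex.continuous_conj.comp_continuousOn (h2.mono hKS)
  · intro x hx
    obtain ⟨ζ, hζ, rfl⟩ := exists_ellipseMap_eq_of_mem_frontier hb hab hx
    rw [forall_isUnitNormal_inner_eq_iff hb hab hζ, fluidVelocity, Complex.conj_conj,
      deriv_ellipsePotential_mul_normal hb hab α r ω w₀ hζ]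
    obtain ⟨hJ, hN⟩ := joukowsky_of_norm_eq_one a b hζ
    have hv : RigidVelocity.field ⟨ω, r, Complex.exp (α * Complex.I) * w₀⟩ (ellipseMap a b α r ζ) =
        Complex.exp (α * Complex.I) * (ω * Complex.I * joukowsky a b ζ + w₀) := by
      simp only [RigidVelocity.field, ellipseMap]; ring
    have he : conj (Complex.exp (α * Complex.I)) * Complex.exp (α * Complex.I) = 1 := by
      rw [← Complex.normSq_eq_conj_mul_self, Complex.normSq_eq_norm_sq, norm_exp_mul_I_eq_one]
      simp
    have hv' : conj (RigidVelocity.field ⟨ω, r, Complex.exp (α * Complex.I) * w₀⟩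
        (ellipseMap a b α r ζ)) * (Complex.exp (α * Complex.I) * joukowskyNormal a b ζ) =
        conj (ω * Complex.I * joukowsky a b ζ + w₀) * joukowskyNormal a b ζ := by
      rw [hv, map_mul]
      linear_combination (conj (ω * Complex.I * joukowsky a b ζ + w₀) * joukowskyNormal a b ζ) * he
    rw [hv', hJ, hN]
    simp [sq]
    ring

theorem exists_limits_ellipsePotential : ∃ μ ν : ℂ,
    Tendsto (fun z => Complex.exp (-(α * Complex.I)) * ellipsePotential a b α r ω w₀ z * z / (a + b))
      (cocompact ℂ) (𝓝 μ) ∧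
    w₀ = -((μ + conj μ) / b + (μ - conj μ) / a) ∧
    Tendsto (fun z => (Complex.exp (-(α * Complex.I)) * (z - r)) ^ 2 *
        ellipsePotential a b α r ω w₀ z
        - (a + b) * μ * (Complex.exp (-(α * Complex.I)) * (z - r)))
      (cocompact ℂ) (𝓝 ν) ∧
    (ω : ℂ) = 16 * Complex.I * ν / ((a ^ 2 - b ^ 2) * (a + b) ^ 2) := by
  have hs' : (a : ℂ) + b ≠ 0 := by exact_mod_cast (by linarith : (a + b : ℝ) ≠ 0)
  have ha' : (a : ℂ) ≠ 0 := by exact_mod_cast (by linarith : (a : ℝ) ≠ 0)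
  have hb' : (b : ℂ) ≠ 0 := by exact_mod_cast hb.ne'
  have hκ' : (a : ℂ) ^ 2 - b ^ 2 ≠ 0 := by
    rw [← focal_sq hb hab]; exact_mod_cast (pow_pos (focal_pos hb hab) 2).ne'
  have hrot := tendsto_rotate_cocompact α r
  set m := ((a : ℂ) + b) ^ 2 * w₀ - ((a : ℂ) ^ 2 - (b : ℂ) ^ 2) * conj w₀ with hm
  set n := Complex.I * ((a : ℂ) ^ 2 - b ^ 2) * ((a : ℂ) + b) ^ 2 * ω with hn
  have h1 := (tendsto_alignedPotential_mul ((a : ℂ) ^ 2 - b ^ 2) m n).comp hrot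
  have h0 := (tendsto_alignedPotential ((a : ℂ) ^ 2 - b ^ 2) m n).comp hrot
  have h2 := (tendsto_alignedPotential_sq ((a : ℂ) ^ 2 - b ^ 2) m n).comp hrot
  refine ⟨-(m / (4 * (a + b))), -(n / 16), ?_, ?_, ?_, ?_⟩
  -- Here z rather than z - r multiplies ξ; the difference, a constant times ξ, tends to 0.
  · have h3 := (h1.add (h0.const_mul (Complex.exp (-(α * Complex.I)) * r))).div_const ((a : ℂ) + b)
    convert h3 using 2
    · rw [ellipsePotential_eq]
      simp only [Function.comp_apply, ← hm, ← hn]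
      ring
    · field_simp; ring
  -- Re μ = -b Re w₀ / 2 and Im μ = -a Im w₀ / 2, so w₀ is recovered from μ and conj μ.
  · rw [hm]
    simp only [map_neg, map_div₀, map_sub, map_mul, map_pow, map_add, Complex.conj_ofReal,
      Complex.conj_conj, map_ofNat]
    field_simp
    ring
  · convert h2 using 2
    rw [ellipsePotential_eq]
    simp only [Function.comp_apply, ← hm, ← hn]
    field_simp
    ring
  · rw [hn]
    field_simp
    linear_combination ω * Complex.I_sq

end

/-! ### Uniqueness of the potential. -/

/-- Maximum principle for e^g, which has modulus 1 on the circle. -/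
theorem re_nonpos_of_re_eq_zero_on_sphere {g : ℂ → ℂ}
    (hg : DiffContOnCl ℂ g (Metric.ball 0 1)) (h0 : ∀ w ∈ Metric.sphere (0 : ℂ) 1, (g w).re = 0)
    {w : ℂ} (hw : w ∈ Metric.ball (0 : ℂ) 1) : (g w).re ≤ 0 := by
  have h1 : DiffContOnCl ℂ (fun w => Complex.exp (g w)) (Metric.ball 0 1) :=
    Complex.differentiable_exp.comp_diffContOnCl hg
  have h2 := Complex.norm_le_of_forall_mem_frontier_norm_le (C := 1) Metric.isBounded_ball h1 (by
    intro z hz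
    rw [frontier_ball _ one_ne_zero] at hz
    rw [Complex.norm_exp, h0 z hz, Real.exp_zero]) (subset_closure hw)
  rwa [Complex.norm_exp, Real.exp_le_one_iff] at h2

/-- Applied to g and -g, the previous bound gives Re g = 0 in the disc; by the open mapping theorem
g is constant. -/
theorem eq_center_of_re_eq_zero_on_sphere {g : ℂ → ℂ}
    (hg : DiffContOnCl ℂ g (Metric.ball 0 1)) (h0 : ∀ w ∈ Metric.sphere (0 : ℂ) 1, (g w).re = 0)
    {w : ℂ} (hw : w ∈ Metric.ball (0 : ℂ) 1) : g w = g 0 := by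
  have hre : ∀ z ∈ Metric.ball (0 : ℂ) 1, (g z).re = 0 := fun z hz => by
    refine le_antisymm (re_nonpos_of_re_eq_zero_on_sphere hg h0 hz) ?_
    have := re_nonpos_of_re_eq_zero_on_sphere hg.neg (fun w hw => by simp [h0 w hw]) hz
    simpa using this
  rcases (hg.differentiableOn.analyticOnNhd Metric.isOpen_ball).is_constant_or_isOpen
    (convex_ball (0 : ℂ) 1).isPreconnected with ⟨c, hc⟩ | h
  · rw [hc w hw, hc 0 (Metric.mem_ball_self one_pos)]
  · exfalso
    have ho := h _ subset_rfl Metric.isOpen_ball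
    obtain ⟨ε, hε, hsub⟩ := Metric.isOpen_iff.1 ho (g 0) ⟨0, Metric.mem_ball_self one_pos, rfl⟩
    have hmem : g 0 + (ε / 2 : ℝ) ∈ Metric.ball (g 0) ε := by
      rw [mem_ball_iff_norm, add_sub_cancel_left, Complex.norm_real,
        Real.norm_of_nonneg (by positivity)]
      linarith
    obtain ⟨z, hz, hgz⟩ := hsub hmem
    have h1 := hre z hz
    rw [hgz, Complex.add_re, hre 0 (Metric.mem_ball_self one_pos), Complex.ofReal_re] at h1
    linarith

theorem tendsto_joukowsky_inv {a b : ℝ} (hb : 0 < b) (hab : b < a) :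
    Tendsto (fun w : ℂ => joukowsky a b w⁻¹) (𝓝[≠] 0) (cocompact ℂ) := by
  have hs' : (a : ℂ) + b ≠ 0 := by exact_mod_cast (by linarith : (a + b : ℝ) ≠ 0)
  rw [← Metric.cobounded_eq_cocompact]
  have h1 : Tendsto (fun w : ℂ => ((a : ℂ) + b + (a - b) * w ^ 2) / 2) (𝓝[≠] 0)
      (𝓝 (((a : ℂ) + b + (a - b) * 0 ^ 2) / 2)) :=
    (Continuous.tendsto (by fun_prop) 0).mono_left nhdsWithin_le_nhds
  have h2 := tendsto_inv₀_nhdsNE_zero (α := ℂ)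
  rw [← tendsto_norm_atTop_iff_cobounded] at h2 ⊢
  have h3 := Tendsto.pos_mul_atTop (norm_pos_iff.2 (by simpa using hs')) h1.norm h2
  refine h3.congr' ?_
  filter_upwards [self_mem_nhdsWithin] with w hw
  have hw : w ≠ 0 := hw
  rw [← norm_mul, joukowsky]
  congr 1
  field_simp

section
variable {a b : ℝ} (hb : 0 < b) (hab : b < a) {α : ℝ} {r : ℂ}
include hb hab

theorem tendsto_ellipseMap_inv :
    Tendsto (fun w : ℂ => ellipseMap a b α r w⁻¹) (𝓝[≠] 0) (cocompact ℂ) := by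
  have h : Tendsto (fun z => Complex.exp (α * Complex.I) * z + r) (cocompact ℂ) (cocompact ℂ) :=
    ((Homeomorph.mulLeft₀ _ (Complex.exp_ne_zero (α * Complex.I))).trans
      (Homeomorph.addRight r)).isClosedEmbedding.tendsto_cocompact
  exact h.comp (tendsto_joukowsky_inv hb hab)

/-- A potential flow outside of an ellipse, at rest at infinity and tangent to the ellipse, is
trivial. -/
theorem eq_zero_of_tangent_flow {W u : ℂ → ℂ}
    (hW : DifferentiableOn ℂ W (fluidDomain (placedEllipse a b α r)))
    (hdecay : Tendsto W (cocompact ℂ) (𝓝 0))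
    (hu : ContinuousOn u (closure (fluidDomain (placedEllipse a b α r))))
    (huW : EqOn u (fluidVelocity W) (fluidDomain (placedEllipse a b α r)))
    (hslip : ∀ ζ : ℂ, ‖ζ‖ = 1 → (conj (u (ellipseMap a b α r ζ)) *
      (Complex.exp (α * Complex.I) * joukowskyNormal a b ζ)).re = 0) :
    EqOn W 0 (fluidDomain (placedEllipse a b α r)) := by
  classical
  have hone : ∀ {w : ℂ}, w ≠ 0 → w ∈ Metric.ball (0 : ℂ) 1 → 1 < ‖w⁻¹‖ := fun hw0 hw => by
    rw [norm_inv]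
    exact (one_lt_inv₀ (norm_pos_iff.2 hw0)).2 (by simpa using hw)
  have hmem : ∀ {w : ℂ}, w ≠ 0 → w ∈ Metric.ball (0 : ℂ) 1 →
      ellipseMap a b α r w⁻¹ ∈ fluidDomain (placedEllipse a b α r) := fun hw0 hw =>
    ellipseMap_mem_fluidDomain hb hab (hone hw0 hw)
  -- In the coordinate w = 1/ζ infinity becomes w = 0, a removable singularity with value 0 by
  -- decay. The function g is w f'(w) in the disc, but defined through u so that it is continuous up
  -- to the circle, where its real part is minus the pairing of u with the normal N.
  set f : ℂ → ℂ := fun w => if w = 0 then 0 else W (ellipseMap a b α r w⁻¹) with hf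
  set g : ℂ → ℂ := fun w => if w = 0 then 0 else -(conj (u (ellipseMap a b α r w⁻¹)) *
    (Complex.exp (α * Complex.I) * joukowskyNormal a b w⁻¹)) with hg
  have hderiv : ∀ {w : ℂ}, w ≠ 0 → w ∈ Metric.ball (0 : ℂ) 1 →
      HasDerivAt f (deriv W (ellipseMap a b α r w⁻¹) * (Complex.exp (α * Complex.I) *
        joukowskyNormal a b w⁻¹ / w⁻¹ * -(w ^ 2)⁻¹)) w := by
    intro w hw0 hw
    have h1 := (hW.differentiableAt ((isOpen_fluidDomain _).mem_nhds (hmem hw0 hw))).hasDerivAt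
    have h2 := (hasDerivAt_ellipseMap a b α r (inv_ne_zero hw0)).comp w (hasDerivAt_inv hw0)
    refine (HasDerivAt.comp w (h₂ := W) h1 h2).congr_of_eventuallyEq ?_
    filter_upwards [isOpen_ne.mem_nhds hw0] with y hy
    simp only [hf, if_neg hy, Function.comp_apply]
  have hf0 : ContinuousAt f 0 := by
    rw [← continuousWithinAt_compl_self, ContinuousWithinAt]
    simp only [hf, if_pos]
    refine (hdecay.comp (tendsto_ellipseMap_inv hb hab (α := α) (r := r))).congr' ?_
    filter_upwards [self_mem_nhdsWithin] with y hy
    rw [if_neg (show y ≠ 0 from hy), Function.comp_apply]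
  have hfd : DifferentiableOn ℂ f (Metric.ball 0 1) := by
    rw [← Complex.differentiableOn_compl_singleton_and_continuousAt_iff
      (Metric.ball_mem_nhds (0 : ℂ) one_pos)]
    exact ⟨fun w hw => (hderiv hw.2 hw.1).differentiableAt.differentiableWithinAt, hf0⟩
  have hgf : EqOn g (fun w => w * deriv f w) (Metric.ball 0 1) := by
    intro w hw
    by_cases hw0 : w = 0
    · simp [hg, hw0]
    · simp only [hg, if_neg hw0]
      rw [(hderiv hw0 hw).deriv, huW (hmem hw0 hw), fluidVelocity, Complex.conj_conj]
      field_simp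
  have hgd : DifferentiableOn ℂ g (Metric.ball 0 1) :=
    (differentiableOn_id.mul (hfd.deriv Metric.isOpen_ball)).congr hgf
  have hgc : ContinuousOn g (Metric.closedBall 0 1) := by
    intro w hw
    by_cases hw0 : w = 0
    · rw [hw0]
      exact ((hgd.continuousOn).continuousAt
        (Metric.ball_mem_nhds (0 : ℂ) one_pos)).continuousWithinAt
    · have h1 : ContinuousOn g (Metric.closedBall 0 1 \ {0}) := by
        have hinv : ContinuousOn (fun w : ℂ => w⁻¹) (Metric.closedBall 0 1 \ {0}) :=
          continuousOn_inv₀.mono fun _ h => h.2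
        have hmap : ContinuousOn (fun w : ℂ => ellipseMap a b α r w⁻¹)
            (Metric.closedBall 0 1 \ {0}) := fun y hy =>
          (ContinuousAt.comp (f := fun w : ℂ => w⁻¹)
            (hasDerivAt_ellipseMap a b α r (inv_ne_zero hy.2)).continuousAt
            (continuousAt_inv₀ hy.2)).continuousWithinAt
        have hnor : ContinuousOn (fun w : ℂ => joukowskyNormal a b w⁻¹)
            (Metric.closedBall 0 1 \ {0}) := by
          simp only [joukowskyNormal, div_inv_eq_mul]
          fun_prop
        have hu' : ContinuousOn (fun w : ℂ => u (ellipseMap a b α r w⁻¹))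
            (Metric.closedBall 0 1 \ {0}) := by
          refine hu.comp hmap fun y hy => ellipseMap_mem_closure_fluidDomain hb hab ?_
          rw [norm_inv]
          exact (one_le_inv₀ (norm_pos_iff.2 hy.2)).2 (by simpa using hy.1)
        refine ContinuousOn.congr (f := fun w => -(conj (u (ellipseMap a b α r w⁻¹)) *
          (Complex.exp (α * Complex.I) * joukowskyNormal a b w⁻¹))) ?_
          fun y hy => by simp only [hg, if_neg (show y ≠ 0 from hy.2)]
        exact ((Complex.continuous_conj.comp_continuousOn hu').mul
          (continuousOn_const.mul hnor)).neg
      refine (h1 w ⟨hw, hw0⟩).mono_of_mem_nhdsWithin ?_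
      rw [sdiff_eq]
      exact inter_mem self_mem_nhdsWithin
        (mem_nhdsWithin_of_mem_nhds (isOpen_compl_singleton.mem_nhds hw0))
  have hgz : ∀ w ∈ Metric.ball (0 : ℂ) 1, g w = 0 := fun w hw => by
    have h0 : g 0 = 0 := by simp [hg]
    rw [← h0]
    refine eq_center_of_re_eq_zero_on_sphere ⟨hgd, ?_⟩ ?_ hw
    · rwa [closure_ball _ one_ne_zero]
    · intro z hz
      have hz1 : ‖z‖ = 1 := by simpa using hz
      have hz0 : z ≠ 0 := by rintro rfl; norm_num at hz1
      simp only [hg, if_neg hz0, Complex.neg_re]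
      rw [hslip _ (by rw [norm_inv, hz1, inv_one]), neg_zero]
  have hder0 : ∀ w ∈ Metric.ball (0 : ℂ) 1, w ≠ 0 → deriv f w = 0 := fun w hw hw0 => by
    have := hgz w hw
    rw [hgf hw] at this
    exact (mul_eq_zero.1 this).resolve_left hw0
  have hder : EqOn (deriv f) 0 (Metric.ball 0 1) := by
    intro w hw
    by_cases hw0 : w = 0
    · rw [hw0]
      have hc : ContinuousAt (deriv f) 0 := (hfd.deriv Metric.isOpen_ball).continuousOn.continuousAt
        (Metric.ball_mem_nhds (0 : ℂ) one_pos)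
      refine tendsto_nhds_unique (hc.tendsto.mono_left (nhdsWithin_le_nhds (s := {0}ᶜ))) ?_
      refine tendsto_const_nhds.congr' ?_
      filter_upwards [self_mem_nhdsWithin, mem_nhdsWithin_of_mem_nhds
        (Metric.ball_mem_nhds (0 : ℂ) one_pos)] with y hy hy1
      rw [hder0 y hy1 hy]; rfl
    · exact hder0 w hw hw0
  intro z hz
  obtain ⟨ζ, hζ, rfl⟩ := exists_ellipseMap_eq_of_mem_fluidDomain hb hab hz
  have hζ0 : ζ ≠ 0 := by rintro rfl; norm_num at hζ
  have hball : ζ⁻¹ ∈ Metric.ball (0 : ℂ) 1 := by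
    rw [mem_ball_zero_iff, norm_inv]
    exact inv_lt_one_of_one_lt₀ hζ
  have hconst := Metric.isOpen_ball.is_const_of_deriv_eq_zero
    (convex_ball (0 : ℂ) 1).isPreconnected hfd hder hball (Metric.mem_ball_self one_pos)
  simpa [hf, hζ0] using hconst

/-- The potential of an ellipse is unique in the fluid domain. -/
theorem IsComplexPotential.eqOn_of_placedEllipse {v : RigidVelocity} {ξ η : ℂ → ℂ}
    (hξ : IsComplexPotential (placedEllipse a b α r) v ξ)
    (hη : IsComplexPotential (placedEllipse a b α r) v η) :
    EqOn η ξ (fluidDomain (placedEllipse a b α r)) := by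
  obtain ⟨u₁, hc₁, he₁, hs₁⟩ := hξ.slip
  obtain ⟨u₂, hc₂, he₂, hs₂⟩ := hη.slip
  have hd : ∀ {f : ℂ → ℂ}, IsComplexPotential (placedEllipse a b α r) v f →
      ∀ z ∈ fluidDomain (placedEllipse a b α r), DifferentiableAt ℂ f z := fun hf z hz =>
    hf.holomorphic.differentiableAt ((isOpen_fluidDomain _).mem_nhds hz)
  have h := eq_zero_of_tangent_flow hb hab (W := η - ξ) (u := u₂ - u₁)
    (hη.holomorphic.sub hξ.holomorphic) (by have := hη.decay.sub hξ.decay; rwa [sub_zero] at this)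
    (hc₂.sub hc₁) (fun z hz => by
      rw [Pi.sub_apply, he₁ hz, he₂ hz, fluidVelocity, fluidVelocity, fluidVelocity,
        deriv_sub (hd hη z hz) (hd hξ z hz), map_sub]) (fun ζ hζ => by
      have hfr := ellipseMap_mem_frontier hb hab (α := α) (r := r) hζ
      have h₁ := (forall_isUnitNormal_inner_eq_iff hb hab hζ _ _).1 (hs₁ _ hfr)
      have h₂ := (forall_isUnitNormal_inner_eq_iff hb hab hζ _ _).1 (hs₂ _ hfr)
      rw [Pi.sub_apply, map_sub, sub_mul, Complex.sub_re, h₁, h₂, sub_self])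
  intro z hz
  exact sub_eq_zero.1 (h hz)

end

/-! ### Comparison of functions P + Q√D. -/

-- If B ≠ 0, the multiplicity of p is even on the left and odd on the right.
open Polynomial in
theorem Polynomial.eq_zero_of_sq_eq_sq_mul {A B D : ℂ[X]} {p : ℂ} (hD : Odd (D.rootMultiplicity p))
    (h : A ^ 2 = B ^ 2 * D) : B = 0 := by
  by_contra hB
  have hD0 : D ≠ 0 := by rintro rfl; simp at hD
  have hne : B ^ 2 * D ≠ 0 := mul_ne_zero (pow_ne_zero 2 hB) hD0
  have hA2 : A * A ≠ 0 := by rw [← sq, h]; exact hne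
  have h1 := congrArg (rootMultiplicity p) h
  rw [rootMultiplicity_mul hne, sq, rootMultiplicity_mul hA2, sq,
    rootMultiplicity_mul (mul_self_ne_zero.2 hB)] at h1
  obtain ⟨k, hk⟩ := hD
  omega

open Polynomial in
/-- If two functions `P₁ + Q₁ √D₁` and `P₂ + Q₂ √D₂` coincide on an infinite set, then the branch
points of the first one are roots of `D₂`. -/
theorem Polynomial.isRoot_of_add_mul_sqrt_eq {P₁ Q₁ D₁ P₂ Q₂ D₂ : ℂ[X]} {R₁ R₂ : ℂ → ℂ} {U : Set ℂ}
    (hU : U.Infinite) (h₁ : ∀ z ∈ U, R₁ z ^ 2 = D₁.eval z) (h₂ : ∀ z ∈ U, R₂ z ^ 2 = D₂.eval z)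
    (h : ∀ z ∈ U, P₁.eval z + Q₁.eval z * R₁ z = P₂.eval z + Q₂.eval z * R₂ z) (hQ : Q₁ ≠ 0)
    (hD₂ : D₂ ≠ 0) {p : ℂ} (hp : Odd (D₁.rootMultiplicity p)) : D₂.IsRoot p := by
  -- Squaring P₁ - P₂ = Q₂R₂ - Q₁R₁ isolates -2Q₁Q₂R₁R₂; squaring again eliminates both roots. Only
  -- the squares of R₁ and R₂ enter, so no choice of branch matters.
  have key : ((P₁ - P₂) ^ 2 - Q₁ ^ 2 * D₁ - Q₂ ^ 2 * D₂) ^ 2 = (2 * Q₁ * Q₂) ^ 2 * (D₁ * D₂) := by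
    refine eq_of_infinite_eval_eq _ _ (hU.mono fun z hz => ?_)
    have e := h z hz
    have e1 : (P₁.eval z - P₂.eval z) ^ 2 = (Q₂.eval z * R₂ z - Q₁.eval z * R₁ z) ^ 2 := by
      congr 1; linear_combination e
    simp only [mem_ofPred_eq, eval_pow, eval_sub, eval_mul, eval_ofNat, ← h₁ z hz, ← h₂ z hz, e1]
    ring
  by_cases hQ₂ : Q₂ = 0
  · exfalso
    apply hQ
    refine eq_zero_of_sq_eq_sq_mul (A := P₁ - P₂) hp ?_
    have : ((P₁ - P₂) ^ 2 - Q₁ ^ 2 * D₁) ^ 2 = 0 := by simpa [hQ₂] using key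
    exact sub_eq_zero.1 (pow_eq_zero_iff two_ne_zero |>.1 this)
  -- If D₂ did not vanish at p, then D₁D₂ would have odd multiplicity there, forcing Q₁Q₂ = 0.
  · by_contra hroot
    have hD₁ : D₁ ≠ 0 := by rintro rfl; simp at hp
    have hm : Odd ((D₁ * D₂).rootMultiplicity p) := by
      rw [rootMultiplicity_mul (mul_ne_zero hD₁ hD₂), rootMultiplicity_eq_zero hroot, add_zero]
      exact hp
    have := eq_zero_of_sq_eq_sq_mul hm key
    simp [hQ, hQ₂] at this

section Polynomials
open Polynomial

/-- The polynomial `(z'² - κ)`, where `z' = e (z - r)`. -/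
noncomputable def focalPoly (κ e r : ℂ) : ℂ[X] := (C e * (X - C r)) ^ 2 - C κ

/-- The polynomial part of the potential `ξ = P + Q √(z'² - κ)`. -/
noncomputable def regularPoly (κ m n e r : ℂ) : ℂ[X] :=
  -(C (m / (2 * κ)) * (C e * (X - C r)) +
    C (n / (4 * κ ^ 2)) * (2 * (C e * (X - C r)) ^ 2 - C κ))

/-- The coefficient of the square root in the potential `ξ = P + Q √(z'² - κ)`. -/
noncomputable def branchPoly (κ m n e r : ℂ) : ℂ[X] :=
  C (m / (2 * κ)) + C (n / (2 * κ ^ 2)) * (C e * (X - C r))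

theorem alignedPotential_eq_eval {κ e r z : ℂ} (hκ : κ ≠ 0) (he : e ≠ 0) (hz : z ≠ r) (m n : ℂ) :
    alignedPotential κ m n (e * (z - r)) = (regularPoly κ m n e r).eval z +
      (branchPoly κ m n e r).eval z * focalRoot κ (e * (z - r)) := by
  rw [alignedPotential_eq hκ (mul_ne_zero he (sub_ne_zero.2 hz))]
  simp [regularPoly, branchPoly]

theorem focalRoot_sq_eq_eval {κ e r z : ℂ} (he : e ≠ 0) (hz : z ≠ r) :
    focalRoot κ (e * (z - r)) ^ 2 = (focalPoly κ e r).eval z := by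
  rw [focalRoot_sq κ (mul_ne_zero he (sub_ne_zero.2 hz))]
  simp [focalPoly]

theorem branchPoly_injective {κ e r : ℂ} (hκ : κ ≠ 0) (he : e ≠ 0) {m n m' n' : ℂ}
    (h : branchPoly κ m n e r = branchPoly κ m' n' e r) : m = m' ∧ n = n' := by
  have h0 := congrArg (eval r) h
  have h1 := congrArg (eval (r + 1)) h
  simp only [branchPoly, eval_add, eval_C, eval_mul, eval_sub, eval_X, sub_self, mul_zero,
    add_zero, add_sub_cancel_left, mul_one] at h0 h1
  have hm : m = m' := by field_simp at h0; exact h0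
  refine ⟨hm, ?_⟩
  subst hm
  have := add_left_cancel h1
  field_simp at this
  exact this

theorem focalPoly_eq {k e r : ℂ} (he : e ≠ 0) :
    focalPoly (k ^ 2) e r = C (e ^ 2) * ((X - C (r + k * e⁻¹)) * (X - C (r - k * e⁻¹))) := by
  have h1 : e * e⁻¹ = 1 := mul_inv_cancel₀ he
  have h2 : C e * C e⁻¹ = (1 : ℂ[X]) := by rw [← C_mul, h1, C_1]
  simp only [focalPoly, C_add, C_sub, C_mul, C_pow]
  linear_combination (C k ^ 2 * (C e * C e⁻¹ + 1)) * h2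

theorem focalPoly_ne_zero {k e r : ℂ} (he : e ≠ 0) : focalPoly (k ^ 2) e r ≠ 0 := by
  rw [focalPoly_eq he]
  exact mul_ne_zero (C_ne_zero.2 (pow_ne_zero 2 he))
    (mul_ne_zero (X_sub_C_ne_zero _) (X_sub_C_ne_zero _))

theorem focalPoly_isRoot_iff {k e r p : ℂ} (he : e ≠ 0) :
    (focalPoly (k ^ 2) e r).IsRoot p ↔ p = r + k * e⁻¹ ∨ p = r - k * e⁻¹ := by
  rw [focalPoly_eq he, IsRoot.def]
  simp only [eval_mul, eval_C, eval_sub, eval_X, mul_eq_zero, pow_eq_zero_iff, ne_eq,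
    OfNat.ofNat_ne_zero, not_false_eq_true, he, false_or, sub_eq_zero]

theorem focalPoly_rootMultiplicity {k e r p : ℂ} (hk : k ≠ 0) (he : e ≠ 0)
    (hp : p = r + k * e⁻¹ ∨ p = r - k * e⁻¹) : (focalPoly (k ^ 2) e r).rootMultiplicity p = 1 := by
  have hne := focalPoly_ne_zero (k := k) (r := r) he
  have hd : r + k * e⁻¹ ≠ r - k * e⁻¹ := by
    intro h
    have : k * e⁻¹ = 0 := by linear_combination h / 2
    simp [hk, he] at this
  rw [focalPoly_eq he] at hne ⊢
  rw [rootMultiplicity_mul hne, rootMultiplicity_mul (right_ne_zero_of_mul hne),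
    rootMultiplicity_C, rootMultiplicity_X_sub_C, rootMultiplicity_X_sub_C]
  rcases hp with rfl | rfl
  · simp [hd]
  · simp [hd.symm]

end Polynomials

section
variable {a b : ℝ} (hb : 0 < b) (hab : b < a)
include hb hab

theorem sq_sub_sq_ne_zero : (a : ℂ) ^ 2 - b ^ 2 ≠ 0 := by
  rw [← focal_sq hb hab]
  exact_mod_cast (pow_pos (focal_pos hb hab) 2).ne'

/-- Divided by a + b, the first coefficient has real part 2b Re w and imaginary part 2a Im w. -/
theorem velocity_eq_of_coeff_eq {ω ω' : ℝ} {w w' : ℂ}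
    (hm : ((a : ℂ) + b) ^ 2 * w - ((a : ℂ) ^ 2 - b ^ 2) * conj w =
      ((a : ℂ) + b) ^ 2 * w' - ((a : ℂ) ^ 2 - b ^ 2) * conj w')
    (hn : Complex.I * ((a : ℂ) ^ 2 - b ^ 2) * ((a : ℂ) + b) ^ 2 * ω =
      Complex.I * ((a : ℂ) ^ 2 - b ^ 2) * ((a : ℂ) + b) ^ 2 * ω') : ω = ω' ∧ w = w' := by
  have hs' : (a : ℂ) + b ≠ 0 := by exact_mod_cast (by linarith : (a + b : ℝ) ≠ 0)
  have hκ := sq_sub_sq_ne_zero hb hab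
  constructor
  · exact_mod_cast mul_left_cancel₀
      (mul_ne_zero (mul_ne_zero Complex.I_ne_zero hκ) (pow_ne_zero 2 hs')) hn
  · have h1 : (a + b) * w - (a - b) * conj w = (a + b) * w' - (a - b) * conj w' :=
      mul_left_cancel₀ hs' (by linear_combination hm)
    have hre := congrArg Complex.re h1
    have him := congrArg Complex.im h1
    simp at hre him
    have ha : 0 < a := hb.trans hab
    exact Complex.ext (mul_left_cancel₀ hb.ne' (by linarith))
      (mul_left_cancel₀ ha.ne' (by linarith))

omit hb hab in
theorem ne_center_of_mem_fluidDomain {α : ℝ} {r z : ℂ}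
    (hz : z ∈ fluidDomain (placedEllipse a b α r)) : z ≠ r := by
  rintro rfl
  rw [mem_fluidDomain_placedEllipse, sub_self, mul_zero] at hz
  norm_num [ellipseLevel] at hz

theorem ellipsePotential_eq_eval {α : ℝ} {r z : ℂ} (hz : z ≠ r) (ω : ℝ) (w₀ : ℂ) :
    ellipsePotential a b α r ω w₀ z =
      (regularPoly ((a : ℂ) ^ 2 - b ^ 2)
        (((a : ℂ) + b) ^ 2 * w₀ - ((a : ℂ) ^ 2 - b ^ 2) * conj w₀)
        (Complex.I * ((a : ℂ) ^ 2 - b ^ 2) * ((a : ℂ) + b) ^ 2 * ω)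
        (Complex.exp (-(α * Complex.I))) r).eval z +
      (branchPoly ((a : ℂ) ^ 2 - b ^ 2)
        (((a : ℂ) + b) ^ 2 * w₀ - ((a : ℂ) ^ 2 - b ^ 2) * conj w₀)
        (Complex.I * ((a : ℂ) ^ 2 - b ^ 2) * ((a : ℂ) + b) ^ 2 * ω)
        (Complex.exp (-(α * Complex.I))) r).eval z *
      focalRoot ((a : ℂ) ^ 2 - b ^ 2) (Complex.exp (-(α * Complex.I)) * (z - r)) := by
  rw [ellipsePotential_eq, alignedPotential_eq_eval (sq_sub_sq_ne_zero hb hab)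
    (Complex.exp_ne_zero _) hz]

omit hb hab in
-- The ellipse is symmetric about its centre, so its direction matters only up to sign.
theorem placedEllipse_eq_of_exp_eq_or {α α' : ℝ} (r : ℂ)
    (h : Complex.exp (-(α * Complex.I)) = Complex.exp (-(α' * Complex.I)) ∨
      Complex.exp (-(α * Complex.I)) = -Complex.exp (-(α' * Complex.I))) :
    placedEllipse a b α r = placedEllipse a b α' r := by
  ext z
  rw [mem_placedEllipse, mem_placedEllipse]
  rcases h with h | h <;> rw [h]
  simp only [ellipseLevel, neg_mul, Complex.neg_re, Complex.neg_im, neg_div, neg_sq]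

theorem placedEllipse_eq_of_eqOn {α₁ α₂ : ℝ} {r₁ r₂ : ℂ} {ω₁ ω₂ : ℝ} {w₁ w₂ : ℂ}
    (hv : ¬(ω₁ = 0 ∧ w₁ = 0)) {U : Set ℂ} (hU : U.Infinite) (h₁ : ∀ z ∈ U, z ≠ r₁)
    (h₂ : ∀ z ∈ U, z ≠ r₂)
    (h : EqOn (ellipsePotential a b α₁ r₁ ω₁ w₁) (ellipsePotential a b α₂ r₂ ω₂ w₂) U) :
    placedEllipse a b α₁ r₁ = placedEllipse a b α₂ r₂ := by
  have hκ := sq_sub_sq_ne_zero hb hab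
  have hk0 : (√(a ^ 2 - b ^ 2) : ℂ) ≠ 0 := by exact_mod_cast (focal_pos hb hab).ne'
  have he₁ := Complex.exp_ne_zero (-(α₁ * Complex.I))
  have he₂ := Complex.exp_ne_zero (-(α₂ * Complex.I))
  have hroot : ∀ p, (focalPoly ((a : ℂ) ^ 2 - b ^ 2) (Complex.exp (-(α₁ * Complex.I))) r₁).rootMultiplicity p = 1 →
      (focalPoly ((a : ℂ) ^ 2 - b ^ 2) (Complex.exp (-(α₂ * Complex.I))) r₂).IsRoot p := by
    intro p hp
    have hsum := fun z hz => (ellipsePotential_eq_eval hb hab (h₁ z hz) ω₁ w₁).symm.trans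
      ((h hz).trans (ellipsePotential_eq_eval hb hab (h₂ z hz) ω₂ w₂))
    refine Polynomial.isRoot_of_add_mul_sqrt_eq hU
      (fun z hz => focalRoot_sq_eq_eval he₁ (h₁ z hz))
      (fun z hz => focalRoot_sq_eq_eval he₂ (h₂ z hz)) hsum ?_ ?_ (hp ▸ odd_one)
    · intro h0
      have h0' : branchPoly ((a : ℂ) ^ 2 - b ^ 2)
        (((a : ℂ) + b) ^ 2 * w₁ - ((a : ℂ) ^ 2 - b ^ 2) * conj w₁)
        (Complex.I * ((a : ℂ) ^ 2 - b ^ 2) * ((a : ℂ) + b) ^ 2 * ω₁)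
        (Complex.exp (-(α₁ * Complex.I))) r₁ =
        branchPoly ((a : ℂ) ^ 2 - b ^ 2) 0 0 (Complex.exp (-(α₁ * Complex.I))) r₁ := by
        rw [h0]; simp [branchPoly]
      obtain ⟨hm, hn⟩ := branchPoly_injective hκ he₁ h0'
      exact hv (velocity_eq_of_coeff_eq hb hab (w' := 0) (ω' := 0) (by simpa using hm)
        (by simpa using hn))
    · rw [← focal_sq hb hab]
      exact focalPoly_ne_zero he₂
  rw [← focal_sq hb hab] at hroot
  have hp := (focalPoly_isRoot_iff he₂).1
    (hroot _ (focalPoly_rootMultiplicity hk0 he₁ (Or.inl rfl)))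
  have hq := (focalPoly_isRoot_iff he₂).1
    (hroot _ (focalPoly_rootMultiplicity hk0 he₁ (Or.inr rfl)))
  have hk1 : (√(a ^ 2 - b ^ 2) : ℂ) * (Complex.exp (-(α₁ * Complex.I)))⁻¹ ≠ 0 :=
    mul_ne_zero hk0 (inv_ne_zero he₁)
  -- Two distinct foci cannot match the same focus, which excludes two of the four cases. In the
  -- others the half-sum gives the centre and the half-difference the direction up to sign.
  have hcases : r₁ = r₂ ∧ ((Complex.exp (-(α₁ * Complex.I)))⁻¹ = (Complex.exp (-(α₂ * Complex.I)))⁻¹ ∨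
      (Complex.exp (-(α₁ * Complex.I)))⁻¹ = -(Complex.exp (-(α₂ * Complex.I)))⁻¹) := by
    rcases hp with hp | hp <;> rcases hq with hq | hq
    · exact absurd (by linear_combination (hp - hq) / 2) hk1
    · exact ⟨by linear_combination (hp + hq) / 2, Or.inl (mul_left_cancel₀ hk0
        (by linear_combination (hp - hq) / 2))⟩
    · exact ⟨by linear_combination (hp + hq) / 2, Or.inr (mul_left_cancel₀ hk0
        (by linear_combination (hp - hq) / 2))⟩
    · exact absurd (by linear_combination (hp - hq) / 2) hk1
  obtain ⟨rfl, he⟩ := hcases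
  refine placedEllipse_eq_of_exp_eq_or r₁ (he.imp inv_inj.1 fun h => ?_)
  rw [← inv_neg] at h
  exact inv_inj.1 h

theorem velocity_eq_of_eqOn {α : ℝ} {r : ℂ} {ω₁ ω₂ : ℝ} {w₁ w₂ : ℂ} {U : Set ℂ}
    (hU : U.Infinite) (hr : ∀ z ∈ U, z ≠ r)
    (h : EqOn (ellipsePotential a b α r ω₁ w₁) (ellipsePotential a b α r ω₂ w₂) U) :
    ω₁ = ω₂ ∧ w₁ = w₂ := by
  have hκ := sq_sub_sq_ne_zero hb hab
  have hk0 : (√(a ^ 2 - b ^ 2) : ℂ) ≠ 0 := by exact_mod_cast (focal_pos hb hab).ne'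
  have he := Complex.exp_ne_zero (-(α * Complex.I))
  set m : ℂ → ℂ := fun w => ((a : ℂ) + b) ^ 2 * w - ((a : ℂ) ^ 2 - b ^ 2) * conj w with hm
  set n : ℝ → ℂ := fun ω => Complex.I * ((a : ℂ) ^ 2 - b ^ 2) * ((a : ℂ) + b) ^ 2 * ω with hn
  set e := Complex.exp (-(α * Complex.I))
  set κ := (a : ℂ) ^ 2 - b ^ 2
  -- Both potentials now involve the same root R, so a single squaring suffices and parity at a
  -- focus gives Q₁ = Q₂.
  have key : (regularPoly κ (m w₁) (n ω₁) e r - regularPoly κ (m w₂) (n ω₂) e r) ^ 2 =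
      (branchPoly κ (m w₂) (n ω₂) e r - branchPoly κ (m w₁) (n ω₁) e r) ^ 2 * focalPoly κ e r := by
    refine Polynomial.eq_of_infinite_eval_eq _ _ (hU.mono fun z hz => ?_)
    have h1 := h hz
    rw [ellipsePotential_eq_eval hb hab (hr z hz), ellipsePotential_eq_eval hb hab (hr z hz)] at h1
    simp only [mem_ofPred_eq, Polynomial.eval_pow, Polynomial.eval_sub, Polynomial.eval_mul,
      ← focalRoot_sq_eq_eval he (hr z hz)]
    rw [← mul_pow]
    congr 1
    linear_combination h1
  have hodd : Odd ((focalPoly κ e r).rootMultiplicity (r + √(a ^ 2 - b ^ 2) * e⁻¹)) := by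
    rw [show κ = _ from (focal_sq hb hab).symm, focalPoly_rootMultiplicity hk0 he (Or.inl rfl)]
    exact odd_one
  have hQ := sub_eq_zero.1 (Polynomial.eq_zero_of_sq_eq_sq_mul hodd key)
  obtain ⟨h1, h2⟩ := branchPoly_injective hκ he hQ
  exact velocity_eq_of_coeff_eq hb hab h1.symm h2.symm

end

/-! ### Detectability and conclusion. -/

theorem Placement.solid_solid_standardEllipse (a b : ℝ) (p q : Placement) :
    p.solid (q.solid (standardEllipse a b)) =
      placedEllipse a b (p.angle + q.angle) (p.map (q.map 0)) := by
  rw [placedEllipse, Placement.solid, Placement.solid, Placement.solid, image_image]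
  refine image_congr' fun x => ?_
  simp only [Placement.map]
  push_cast
  rw [add_mul, Complex.exp_add]
  ring

theorem RigidVelocity.exists_field_eq (v : RigidVelocity) (α : ℝ) (r : ℂ) :
    ∃ w₀ : ℂ, RigidVelocity.field ⟨v.angular, r, Complex.exp (α * Complex.I) * w₀⟩ = v.field := by
  refine ⟨Complex.exp (-(α * Complex.I)) * v.field r, ?_⟩
  ext x
  rw [← mul_assoc, ← Complex.exp_add, add_neg_cancel, Complex.exp_zero, one_mul]
  simp only [RigidVelocity.field]
  ring

theorem IsComplexPotential.congr_field {S : Set ℂ} {v v' : RigidVelocity} {ξ : ℂ → ℂ}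
    (h : IsComplexPotential S v ξ) (hv : v'.field = v.field) : IsComplexPotential S v' ξ :=
  ⟨h.holomorphic, h.decay, h.rest, by simpa only [hv] using h.slip⟩

theorem detectable_of_isEllipse {S₀ : Set ℂ} (hS₀ : IsEllipse S₀) : Detectable S₀ := by
  obtain ⟨a, b, q, hb, hab, rfl⟩ := hS₀
  rintro p₁ p₂ v₁ v₂ ξ₁ ξ₂ hv₁ h₁ h₂ ⟨U, hUo, hUne, hUsub, hUeq⟩
  simp only [Placement.solid_solid_standardEllipse] at *
  generalize p₁.angle + q.angle = α₁ at *
  generalize p₁.map (q.map 0) = r₁ at *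
  generalize p₂.angle + q.angle = α₂ at *
  generalize p₂.map (q.map 0) = r₂ at *
  obtain ⟨z₀, hz₀⟩ := hUne
  have hUinf : U.Infinite := infinite_of_mem_nhds z₀ (hUo.mem_nhds hz₀)
  have hne₁ : ∀ z ∈ U, z ≠ r₁ := fun z hz => ne_center_of_mem_fluidDomain (hUsub hz).1
  have hne₂ : ∀ z ∈ U, z ≠ r₂ := fun z hz => ne_center_of_mem_fluidDomain (hUsub hz).2
  have hform : ∀ {α : ℝ} {r : ℂ} {ω : ℝ} {w : ℂ} {v : RigidVelocity} {ξ : ℂ → ℂ},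
      RigidVelocity.field ⟨ω, r, Complex.exp (α * Complex.I) * w⟩ = v.field →
      IsComplexPotential (placedEllipse a b α r) v ξ →
      EqOn ξ (ellipsePotential a b α r ω w) (fluidDomain (placedEllipse a b α r)) :=
    fun hv h => (isComplexPotential_ellipsePotential hb hab _ _ _ _).eqOn_of_placedEllipse hb hab
      (h.congr_field hv)
  obtain ⟨w₁, hw₁⟩ := v₁.exists_field_eq α₁ r₁
  obtain ⟨w₂, hw₂⟩ := v₂.exists_field_eq α₂ r₂
  have hS : placedEllipse a b α₁ r₁ = placedEllipse a b α₂ r₂ := by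
    refine placedEllipse_eq_of_eqOn hb hab (ω₁ := v₁.angular) (w₁ := w₁)
      (ω₂ := v₂.angular) (w₂ := w₂) ?_ hUinf hne₁ hne₂
      fun z hz => ?_
    · rintro ⟨h0, h0'⟩
      refine hv₁ ?_
      rw [← hw₁]
      ext x
      simp [RigidVelocity.field, h0, h0']
    · rw [← hform hw₁ h₁ (hUsub hz).1, ← hform hw₂ h₂ (hUsub hz).2, hUeq hz]
  refine ⟨hS, ?_⟩
  -- Equal ellipses may still have opposite directions, so the second velocity is expressed anew in
  -- the frame of the first before coefficients are compared.
  obtain ⟨w₃, hw₃⟩ := v₂.exists_field_eq α₁ r₁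
  rw [← hS] at h₂ hUsub
  have hvel := velocity_eq_of_eqOn hb hab hUinf hne₁ (w₁ := w₁) (w₂ := w₃) fun z hz => by
    rw [← hform hw₁ h₁ (hUsub hz).1, ← hform hw₃ h₂ (hUsub hz).2, hUeq hz]
  rw [← hw₁, ← hw₃, hvel.1, hvel.2]

theorem isSqrtBranchPoint_ellipsePotential {a b : ℝ} (hb : 0 < b) (hab : b < a) {ε : ℂ}
    (hε : ε ^ 2 = 1) (α : ℝ) (r : ℂ) {ω : ℝ} {w₀ : ℂ} (hv : ¬(ω = 0 ∧ w₀ = 0)) :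
    IsSqrtBranchPoint (ellipsePotential a b α r ω w₀)
      (r + ε * (√(a ^ 2 - b ^ 2) * Complex.exp (α * Complex.I)))
      (ε * Complex.exp (α * Complex.I)) := by
  rw [show ellipsePotential a b α r ω w₀ = _ from funext (ellipsePotential_eq a b α r ω w₀),
    Complex.exp_neg, ← focal_sq hb hab]
  refine isSqrtBranchPoint_alignedPotential (focal_pos hb hab) hε (norm_exp_mul_I_eq_one α) r ?_
  rw [focal_sq hb hab]
  by_contra! h
  exact hv (velocity_eq_of_coeff_eq hb hab (w' := 0) (ω' := 0) (by simpa using h.1)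
    (by simpa using h.2))

theorem proposition1p1 :
    (∀ S₀ : Set ℂ, IsEllipse S₀ → Detectable S₀) ∧
    ∀ (a b : ℝ), 0 < b → b < a → ∀ (α : ℝ) (r : ℂ) (ω : ℝ) (w₀ : ℂ)
      (S : Set ℂ) (v : RigidVelocity) (ξ : ℂ → ℂ) (c : ℂ),
      S = Placement.solid ⟨α, 0, r⟩ (standardEllipse a b) →
      v = ⟨ω, r, Complex.exp (α * Complex.I) * w₀⟩ →
      ξ = ellipsePotential a b α r ω w₀ →
      c = Real.sqrt (a ^ 2 - b ^ 2) * Complex.exp (α * Complex.I) →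
      IsComplexPotential S v ξ ∧
      (∀ η : ℂ → ℂ, IsComplexPotential S v η → EqOn η ξ (fluidDomain S)) ∧
      DifferentiableOn ℂ ξ (segment ℝ (r - c) (r + c))ᶜ ∧
      (v.field ≠ 0 →
        IsSqrtBranchPoint ξ (r + c) (Complex.exp (α * Complex.I)) ∧
        IsSqrtBranchPoint ξ (r - c) (-Complex.exp (α * Complex.I))) ∧
      ∃ μ ν : ℂ,
        Tendsto (fun z => Complex.exp (-(α * Complex.I)) * ξ z * z / (a + b))
          (cocompact ℂ) (𝓝 μ) ∧
        w₀ = -((μ + conj μ) / b + (μ - conj μ) / a) ∧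
        Tendsto (fun z => (Complex.exp (-(α * Complex.I)) * (z - r)) ^ 2 * ξ z
            - (a + b) * μ * (Complex.exp (-(α * Complex.I)) * (z - r)))
          (cocompact ℂ) (𝓝 ν) ∧
        (ω : ℂ) = 16 * Complex.I * ν / ((a ^ 2 - b ^ 2) * (a + b) ^ 2) := by
  refine ⟨fun S₀ => detectable_of_isEllipse, ?_⟩
  rintro a b hb hab α r ω w₀ S v ξ c rfl rfl rfl rfl
  have hpot := isComplexPotential_ellipsePotential hb hab α r ω w₀
  refine ⟨hpot, fun η hη => hpot.eqOn_of_placedEllipse hb hab hη, fun z hz =>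
    (differentiableAt_ellipsePotential hb hab α r ω w₀ fun h =>
      hz (mem_segment_of_rotate_mem (focal_pos hb hab) h)).differentiableWithinAt, fun hv => ?_,
    exists_limits_ellipsePotential hb hab α r ω w₀⟩
  have hv' : ¬(ω = 0 ∧ w₀ = 0) := by
    rintro ⟨rfl, rfl⟩
    exact hv (by ext x; simp [RigidVelocity.field])
  constructor
  · simpa using isSqrtBranchPoint_ellipsePotential hb hab (ε := 1) (by norm_num) α r hv'
  · simpa [sub_eq_add_neg] using
      isSqrtBranchPoint_ellipsePotential hb hab (ε := -1) (by norm_num) α r hv'
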